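/- Let $I=[0,1]$, and let $m$ be Lebesgue measure on $I\times I$. For $\beta_1,\beta_2\in(0,1)$ let $F_{\beta_1,\beta_2}:I\times I\to I\times I$ be the skew product $$F_{\beta_1,\beta_2}(x,y)=\begin{cases}(2x,\;y+y(1-y)(y-\beta_1)) & 0\le x\le 1/2,\\ (2x-1,\;y-y(1-y)(y-\beta_2)) & 1/2<x\le 1,\end{cases}$$ and put $A_j=N_j=I\times\{j\}$ for $j=0,1$. **Definitions.** For a map $F$ of $I\times I$ and a compact set $A$ with $F(A)=A$, the basin $\mathcal B(A)$ is the set of points whose $\omega$-limit set lies in $A$. The set $A$ is *transitive* if $\omega(z)=A$ for some $z\in A$. It is a *Milnor attractor* if $m(\mathcal B(A))>0$ and no proper compact subset of $A$ has the same basin up to a null set. It is an *essential attractor* if $m(B_\delta(A)\cap\mathcal B(A))/m(B_\delta(A))\to1$ as $\delta\to0^+$. It is a *chaotic attractor* if it is a transitive Milnor attractor that carries an ergodic invariant probability measure with a positive Lyapunov exponent and is not uniquely ergodic. The basin is *riddled* if its complement meets every disk in a set of positive measure. A Milnor attractor $A$ has a *locally riddled basin* if there is a neighbourhood $U$ of $A$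 with $m\big(B_\varepsilon(z)\cap(\bigcap_{n\ge0}F^{-n}(U))^c\big)>0$ for all $z\in A$, $\varepsilon>0$. A transitive invariant set $A$ is a *chaotic saddle* if $\mathcal B(A)$ meets some neighbourhood of $A$ but $m(\mathcal B(A))=0$. An *SRB measure* on $A\subseteq N_j$ is an ergodic invariant probability measure with support $A$ that is absolutely continuous with respect to length on $N_j$. A family $F_p$ undergoes a *subcritical (hysteretic) blowout bifurcation* of $A\subseteq N_j$ when $p$ passes through $p_0$ from a region $R^-$ to a region $R^+$ (both having $p_0$ in their closure) if the following hold. 1. The restriction of $F_p$ to $N_j$ does not depend on $p$, and $A$ is an asymptotically stable attractor for it. 2. $A$ carries an SRB measure $\mu$ (the same for all $p$) whose normal Lyapunov exponent $\Lambda(p)$ (the $\mu$-almost everywhere growth rate of the derivative of $F_p^n$ in the direction normal to $N_j$) exists, depends continuously on $p$, vanishes at $p_0$, and is negative for $p\in R^-$ near $p_0$ and positive for $p\in R^+$ near $p_0$. 3. For all $p\in R^-$ near $p_0$, the set $A$ is a chaotic attractor and an essential attractor of $F_p$, and its basin is locally riddled and riddled. 4. For all $p\in R^+$ near $p_0$,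 the set $A$ is a chaotic saddle. Moreover there is a neighbourhood $U$ of $N_j$, independent of $p$, such that for all $p\in R^+$ near $p_0$ and almost every $z\in U$ one has $F_p^n(z)\notin U$ for all sufficiently large $n$. **Corollary.** (a) For every point $(\beta_1,\beta_2)\in(0,1)^2$ with $\beta_1<1/2$ and $\beta_2=\frac1{1-\beta_1}-1$, the family $F$ undergoes a subcritical (hysteretic) blowout bifurcation of $A_0$ at this point, on passing from the region $\beta_2<\frac1{1-\beta_1}-1$ to the region $\beta_2>\frac1{1-\beta_1}-1$. (b) For every point $(\beta_1,\beta_2)\in(0,1)^2$ with $\beta_1>1/2$ and $\beta_2=2-\frac1{\beta_1}$, the family $F$ undergoes a subcritical (hysteretic) blowout bifurcation of $A_1$ at this point, on passing from the region $\beta_2>2-\frac1{\beta_1}$ to the region $\beta_2<2-\frac1{\beta_1}$. -/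

import Mathlib

open Set Filter Topology MeasureTheory

/-! ### Attractors, basins and riddling for a self-map of a metric measure space -/

section Attractors

variable {X : Type*} [MetricSpace X] [MeasureSpace X]

/-- The `ω`-limit set of `z`: the limit points of the orbit `F^n z`. -/
def omegaSet (F : X → X) (z : X) : Set X :=
  {w | MapClusterPt w atTop (fun n : ℕ => F^[n] z)}

/-- The basin of attraction of `A`. -/
def basin (F : X → X) (A : Set X) : Set X :=
  {z | omegaSet F z ⊆ A}

/-- `A` is a compact set with `F(A) = A`. -/
def IsCompactInvariant (F : X → X) (A : Set X) : Prop :=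
  IsCompact A ∧ F '' A = A

def IsTransitiveSet (F : X → X) (A : Set X) : Prop :=
  ∃ z ∈ A, omegaSet F z = A

/-- `A` is an asymptotically stable attractor of the restriction of `F` to `N`: it is Lyapunov
stable inside `N`, and its basin contains a neighbourhood of `A` in `N`. -/
def IsAsymptoticallyStableIn (F : X → X) (N A : Set X) : Prop :=
  IsCompactInvariant F A ∧ A ⊆ N ∧ MapsTo F N N ∧
    (∀ U ∈ 𝓝ˢ A, ∃ V ∈ 𝓝ˢ A, ∀ z ∈ V ∩ N, ∀ n : ℕ, F^[n] z ∈ U) ∧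
    ∃ V ∈ 𝓝ˢ A, V ∩ N ⊆ basin F A

def IsMilnorAttractor (F : X → X) (A : Set X) : Prop :=
  IsCompactInvariant F A ∧ 0 < (volume : Measure X) (basin F A) ∧
    ¬ ∃ A' : Set X, A' ⊂ A ∧ IsCompact A' ∧ basin F A' =ᵐ[volume] basin F A

def IsEssentialAttractor (F : X → X) (A : Set X) : Prop :=
  IsCompactInvariant F A ∧
    Tendsto
      (fun δ : ℝ => (volume : Measure X) (Metric.thickening δ A ∩ basin F A) /
        (volume : Measure X) (Metric.thickening δ A))
      (𝓝[>] 0) (𝓝 1)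

/-- The complement of the basin of `A` meets every disk in a set of positive measure. -/
def HasRiddledBasin (F : X → X) (A : Set X) : Prop :=
  ∀ (z : X) (ε : ℝ), 0 < ε → 0 < (volume : Measure X) (Metric.ball z ε ∩ (basin F A)ᶜ)

def HasLocallyRiddledBasin (F : X → X) (A : Set X) : Prop :=
  IsMilnorAttractor F A ∧
    ∃ U ∈ 𝓝ˢ A, ∀ z ∈ A, ∀ ε : ℝ, 0 < ε →
      0 < (volume : Measure X) (Metric.ball z ε ∩ (⋂ n : ℕ, F^[n] ⁻¹' U)ᶜ)

def IsChaoticSaddle (F : X → X) (A : Set X) : Prop :=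
  IsCompactInvariant F A ∧ IsTransitiveSet F A ∧
    (∃ U ∈ 𝓝ˢ A, (basin F A ∩ U).Nonempty) ∧ (volume : Measure X) (basin F A) = 0

/-- `μ` is an ergodic invariant probability measure carried by `A`. -/
def IsErgodicMeasureOn (F : X → X) (A : Set X) (μ : Measure X) : Prop :=
  IsProbabilityMeasure μ ∧ Ergodic F μ ∧ μ Aᶜ = 0

end Attractors

/-! ### Maps of the unit square: derivatives, Lyapunov exponents, SRB measures -/

/-- The unit square `[0,1] × [0,1]`, with its Lebesgue measure as `volume`. -/
abbrev Square : Type := unitInterval × unitInterval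

/-- The horizontal segment `N_j = [0,1] × {j}`. -/
def lineAt (j : unitInterval) : Set Square := {z | z.2 = j}

/-- The derivative of `F` at `z`, taken within the square. -/
noncomputable def squareDeriv (F : Square → Square) (z : Square) : ℝ × ℝ →L[ℝ] ℝ × ℝ :=
  fderivWithin ℝ
    (fun w : ℝ × ℝ =>
      (((F (projIcc 0 1 zero_le_one w.1, projIcc 0 1 zero_le_one w.2)).1 : ℝ),
        ((F (projIcc 0 1 zero_le_one w.1, projIcc 0 1 zero_le_one w.2)).2 : ℝ)))
    (Icc (0 : ℝ) 1 ×ˢ Icc (0 : ℝ) 1) ((z.1 : ℝ), (z.2 : ℝ))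

/-- The Lyapunov exponent of `F` at `z` in the direction `v` exists and equals `l`. -/
def HasLyapunovExponentAt (F : Square → Square) (z : Square) (v : ℝ × ℝ) (l : ℝ) : Prop :=
  Tendsto (fun n : ℕ => (1 / (n : ℝ)) * Real.log ‖squareDeriv F^[n] z v‖) atTop (𝓝 l)

/-- The normal Lyapunov exponent, at a point `z` of an invariant horizontal segment, exists and
equals `l`. The normal direction is spanned by `(0,1)`, and the orthogonal projection onto it is
the second coordinate. -/
def HasNormalExponentAt (F : Square → Square) (z : Square) (l : ℝ) : Prop :=
  Tendsto (fun n : ℕ => (1 / (n : ℝ)) * Real.log ‖(squareDeriv F^[n] z ((0 : ℝ), (1 : ℝ))).2‖)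
    atTop (𝓝 l)

/-- `A` is a transitive Milnor attractor that carries an ergodic measure with a positive Lyapunov
exponent and is not uniquely ergodic. -/
def IsChaoticAttractor (F : Square → Square) (A : Set Square) : Prop :=
  IsMilnorAttractor F A ∧ IsTransitiveSet F A ∧
    ∃ μ : Measure Square, IsErgodicMeasureOn F A μ ∧
      (∃ l : ℝ, 0 < l ∧ ∀ᵐ z ∂μ, ∃ v : ℝ × ℝ, v ≠ 0 ∧ HasLyapunovExponentAt F z v l) ∧
      ∃ ν : Measure Square, IsErgodicMeasureOn F A ν ∧ ν ≠ μ

/-- `μ` is an SRB measure on `A ⊆ N_j` for the restriction of `F` to `N_j`. The segment `N_j` is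
one-dimensional and is expanded, so that unstable manifolds are open pieces of `N_j`, and absolute
continuity along them is absolute continuity with respect to length on `N_j`. -/
def IsSRBMeasure (F : Square → Square) (j : unitInterval) (A : Set Square)
    (μ : Measure Square) : Prop :=
  IsErgodicMeasureOn F A μ ∧ μ.support = A ∧
    μ ≪ (volume : Measure unitInterval).map (fun x => (x, j))

/-! ### Hysteretic blowout bifurcations -/

/-- The family `F p` of maps of the square, with `p` in a parameter space `P`, undergoes a
hysteretic (subcritical) blowout bifurcation of the set `A ⊆ N_j` when the parameter passes through
`p₀` from the region `Pre` to the region `Post`. -/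
structure IsHystereticBlowout {P : Type*} [TopologicalSpace P] (F : P → Square → Square)
    (j : unitInterval) (A : Set Square) (Pre Post : Set P) (p₀ : P) : Prop where
  /-- `p₀` is approached from both regions. -/
  mem_closure : p₀ ∈ closure Pre ∧ p₀ ∈ closure Post
  /-- The parameter is normal: it does not change the dynamics on `N_j`. -/
  normal_parameter : ∀ p q : P, EqOn (F p) (F q) (lineAt j)
  /-- `A` is an asymptotically stable attractor of the restriction to `N_j`. -/
  stable_in_line : ∀ p : P, IsAsymptoticallyStableIn (F p) (lineAt j) A
  /-- `A` carries an SRB measure, whose normal Lyapunov exponent `Λ` depends continuously on the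
  parameter and crosses zero at `p₀`, from negative to positive. -/
  crossing : ∃ (μ : Measure Square) (Λ : P → ℝ),
    (∀ p : P, IsSRBMeasure (F p) j A μ) ∧
    (∀ p : P, ∀ᵐ z ∂μ, HasNormalExponentAt (F p) z (Λ p)) ∧
    Continuous Λ ∧ Λ p₀ = 0 ∧
    (∀ᶠ p in 𝓝[Pre] p₀, Λ p < 0) ∧ (∀ᶠ p in 𝓝[Post] p₀, 0 < Λ p)
  /-- Before the bifurcation `A` is a chaotic attractor of the whole system, with a riddled
  basin. -/
  riddled : ∀ᶠ p in 𝓝[Pre] p₀,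
    IsChaoticAttractor (F p) A ∧ IsEssentialAttractor (F p) A ∧
      HasLocallyRiddledBasin (F p) A ∧ HasRiddledBasin (F p) A
  /-- After the bifurcation `A` is a chaotic saddle. -/
  saddle : ∀ᶠ p in 𝓝[Post] p₀, IsChaoticSaddle (F p) A
  /-- The loss of stability is hard: after the bifurcation, almost all points of a neighbourhood of
  `N_j`, which does not shrink as the parameter tends to `p₀`, move away from it and never
  return. -/
  hard_loss : ∃ U ∈ 𝓝ˢ (lineAt j), ∀ᶠ p in 𝓝[Post] p₀,
    ∀ᵐ z : Square, z ∈ U → ∀ᶠ n : ℕ in atTop, (F p)^[n] z ∉ U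

/-! ### The family of skew products with cubic fiber maps -/

noncomputable section

/-- The parameter square `(0,1) × (0,1)`. -/
abbrev Param : Type := Ioo (0 : ℝ) 1 × Ioo (0 : ℝ) 1

/-- The expanding base map: `2x` for `x ≤ 1/2`, and `2x - 1` for `x > 1/2`. -/
def baseMap (x : unitInterval) : unitInterval :=
  if h : (x : ℝ) ≤ 1 / 2 then
    ⟨2 * (x : ℝ), by constructor <;> linarith [x.2.1]⟩
  else
    ⟨2 * (x : ℝ) - 1, by constructor <;> linarith [x.2.2, not_le.mp h]⟩

/-- The first fiber map, `y + y(1-y)(y-β)`. -/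
def fiberOne (β : Ioo (0 : ℝ) 1) (y : unitInterval) : unitInterval :=
  ⟨(y : ℝ) + y * (1 - y) * (y - β), by
    obtain ⟨y, hy0, hy1⟩ := y
    obtain ⟨b, hb0, hb1⟩ := β
    simp only
    constructor
    · have h1 : 0 ≤ 1 + (1 - y) * (y - b) := by nlinarith
      nlinarith [mul_nonneg hy0 h1]
    · have h1 : 0 ≤ 1 - y * (y - b) := by nlinarith
      nlinarith [mul_nonneg (sub_nonneg.mpr hy1) h1]⟩

/-- The second fiber map, `y - y(1-y)(y-β)`. -/
def fiberTwo (β : Ioo (0 : ℝ) 1) (y : unitInterval) : unitInterval :=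
  ⟨(y : ℝ) - y * (1 - y) * (y - β), by
    obtain ⟨y, hy0, hy1⟩ := y
    obtain ⟨b, hb0, hb1⟩ := β
    simp only
    constructor
    · have h1 : 0 ≤ 1 - (1 - y) * (y - b) := by nlinarith
      nlinarith [mul_nonneg hy0 h1]
    · have h1 : 0 ≤ 1 + y * (y - b) := by nlinarith
      nlinarith [mul_nonneg (sub_nonneg.mpr hy1) h1]⟩

/-- The skew product `F_{β₁,β₂}` with cubic fiber maps. -/
def cubicSkew (p : Param) (z : Square) : Square :=
  (baseMap z.1, if (z.1 : ℝ) ≤ 1 / 2 then fiberOne p.1 z.2 else fiberTwo p.2 z.2)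

end

/-! ### The doubling map of the unit interval -/

/-! Under Lebesgue measure the binary digits read by the doubling map are independent fair coins, so
the skew product is a random iteration of the two fiber maps (`lintegral_branch`). Each fiber map
multiplies the distance to an end point by a positive continuous factor. By the law of large
numbers, the normal exponent of a segment is half the sum of the logarithms of the two factors
there: `log ((1-β₁)(1+β₂)) / 2` at height 0 and `log (β₁(2-β₂)) / 2` at height 1. The two curves of
the theorem are the zero sets of these exponents.

Let `j` be the bifurcating end and `k` the other one. On the curve two open conditions hold, hence
also nearby: the exponent at `k` is negative, and the average of the two fiber maps moves every
interior height towards `k`, because the cubic terms cancel in the sum (`dist_fiber_add`).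

A segment with negative exponent attracts most nearby points: a small power of the distance
decreases on average, so the probability of escape vanishes as the starting height approaches the
segment (`tendsto_volume_notMem_basin`). The drift then lets some finite choice of digits bring any
height off the opposite segment close to `k`, so the basin of the segment at `k` has positive
measure in every ball (`volume_ball_inter_basin_pos`). Before the bifurcation this basin riddles
that of the segment at `j`.

After the bifurcation `j` repels, `k` attracts and the drift between them points to `k`. One
Lyapunov function on the whole fiber then shows that almost every orbit converges to the segment at
`k` (`ae_mem_basin_of_drift`), which gives both the chaotic saddle and the hard loss of stability.
-/

lemma coe_baseMap_of_le {x : unitInterval} (h : (x : ℝ) ≤ 1 / 2) :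
    (baseMap x : ℝ) = 2 * x := by
  simp only [baseMap, h, dif_pos]

lemma coe_baseMap_of_lt {x : unitInterval} (h : 1 / 2 < (x : ℝ)) :
    (baseMap x : ℝ) = 2 * x - 1 := by
  simp only [baseMap, not_le.mpr h, dif_neg, not_false_eq_true]

lemma measurableSet_le_half : MeasurableSet {x : unitInterval | (x : ℝ) ≤ 1 / 2} :=
  measurableSet_le measurable_subtype_coe measurable_const

lemma measurable_baseMap : Measurable baseMap := by
  have h : (fun x : unitInterval => (baseMap x : ℝ)) =
      fun x : unitInterval => if (x : ℝ) ≤ 1 / 2 then 2 * (x : ℝ) else 2 * x - 1 := by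
    funext x
    split_ifs with hx
    · exact coe_baseMap_of_le hx
    · exact coe_baseMap_of_lt (not_le.mp hx)
  refine Measurable.subtype_mk (f := fun x : unitInterval => (baseMap x : ℝ)) ?_
    (h := fun x => (baseMap x).2)
  rw [h]
  exact Measurable.ite measurableSet_le_half (by fun_prop) (by fun_prop)

lemma map_baseMap_restrict_le :
    (volume.restrict {x : unitInterval | (x : ℝ) ≤ 1 / 2}).map baseMap =
      (2⁻¹ : ENNReal) • volume := by
  refine Measure.ext_of_Iic _ _ fun a => ?_
  rw [Measure.map_apply measurable_baseMap measurableSet_Iic,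
    Measure.restrict_apply (measurable_baseMap measurableSet_Iic)]
  have : baseMap ⁻¹' Iic a ∩ {x : unitInterval | (x : ℝ) ≤ 1 / 2} =
      Iic ⟨(a : ℝ) / 2, by constructor <;> linarith [a.2.1, a.2.2]⟩ := by
    ext x
    simp only [mem_inter_iff, mem_preimage, mem_Iic, mem_ofPred_eq, ← Subtype.coe_le_coe]
    constructor
    · rintro ⟨h1, h2⟩
      rw [coe_baseMap_of_le h2] at h1
      linarith
    · intro h
      have h2 : (x : ℝ) ≤ 1 / 2 := by linarith [a.2.2]
      rw [coe_baseMap_of_le h2]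
      exact ⟨by linarith, h2⟩
  rw [this, unitInterval.volume_Iic, Measure.smul_apply, unitInterval.volume_Iic, smul_eq_mul]
  simp only
  rw [div_eq_inv_mul, ENNReal.ofReal_mul (by norm_num), ENNReal.ofReal_inv_of_pos (by norm_num)]
  norm_num

lemma map_baseMap_restrict_gt :
    (volume.restrict {x : unitInterval | (x : ℝ) ≤ 1 / 2}ᶜ).map baseMap =
      (2⁻¹ : ENNReal) • volume := by
  refine Measure.ext_of_Iic _ _ fun a => ?_
  rw [Measure.map_apply measurable_baseMap measurableSet_Iic,
    Measure.restrict_apply (measurable_baseMap measurableSet_Iic)]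
  have : baseMap ⁻¹' Iic a ∩ {x : unitInterval | (x : ℝ) ≤ 1 / 2}ᶜ =
      Ioc ⟨1 / 2, by constructor <;> norm_num⟩
        ⟨(a : ℝ) / 2 + 1 / 2, by constructor <;> linarith [a.2.1, a.2.2]⟩ := by
    ext x
    simp only [mem_inter_iff, mem_preimage, mem_Iic, mem_compl_iff, mem_ofPred_eq, mem_Ioc, not_le,
      ← Subtype.coe_le_coe, ← Subtype.coe_lt_coe]
    constructor
    · rintro ⟨h1, h2⟩
      rw [coe_baseMap_of_lt h2] at h1
      exact ⟨h2, by linarith⟩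
    · rintro ⟨h2, h⟩
      rw [coe_baseMap_of_lt h2]
      exact ⟨by linarith, h2⟩
  rw [this, unitInterval.volume_Ioc, Measure.smul_apply, unitInterval.volume_Iic, smul_eq_mul]
  simp only [add_sub_cancel_right]
  rw [div_eq_inv_mul, ENNReal.ofReal_mul (by norm_num), ENNReal.ofReal_inv_of_pos (by norm_num)]
  norm_num

/-- The first digit is a fair coin independent of the image point, since each branch stretches its
half over the whole interval with half the mass. All later averages over random choices come from
this identity. -/
lemma lintegral_branch {H₁ H₂ : unitInterval → ENNReal} (h₁ : Measurable H₁) (h₂ : Measurable H₂) :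
    ∫⁻ x : unitInterval, (if (x : ℝ) ≤ 1 / 2 then H₁ (baseMap x) else H₂ (baseMap x)) =
      2⁻¹ * ((∫⁻ x, H₁ x) + ∫⁻ x, H₂ x) := by
  rw [← lintegral_add_compl _ measurableSet_le_half,
    setLIntegral_congr_fun (f := fun x : unitInterval =>
      if (x : ℝ) ≤ 1 / 2 then H₁ (baseMap x) else H₂ (baseMap x)) measurableSet_le_half
      (g := fun x => H₁ (baseMap x)) (fun x hx => if_pos hx),
    setLIntegral_congr_fun (f := fun x : unitInterval =>
      if (x : ℝ) ≤ 1 / 2 then H₁ (baseMap x) else H₂ (baseMap x)) measurableSet_le_half.compl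
      (g := fun x => H₂ (baseMap x)) (fun x hx => if_neg hx),
    ← lintegral_map h₁ measurable_baseMap, ← lintegral_map h₂ measurable_baseMap,
    map_baseMap_restrict_le, map_baseMap_restrict_gt, lintegral_smul_measure,
    lintegral_smul_measure, smul_eq_mul, smul_eq_mul, mul_add]

lemma measurePreserving_baseMap : MeasurePreserving baseMap volume volume := by
  refine ⟨measurable_baseMap, ?_⟩
  conv_lhs => rw [← Measure.restrict_add_restrict_compl (μ := (volume : Measure unitInterval))
    measurableSet_le_half]
  rw [Measure.map_add _ _ measurable_baseMap, map_baseMap_restrict_le, map_baseMap_restrict_gt,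
    ← add_smul, ENNReal.inv_two_add_inv_two, one_smul]

instance : (volume : Measure unitInterval).IsOpenPosMeasure := by
  refine ⟨fun U hU hne => ?_⟩
  obtain ⟨V, hV, rfl⟩ := isOpen_induced_iff.mp hU
  obtain ⟨x, hx⟩ := hne
  have hcl : (x : ℝ) ∈ closure (Ioo (0 : ℝ) 1) := by
    rw [closure_Ioo zero_ne_one]; exact x.2
  have hVo : (V ∩ Ioo (0 : ℝ) 1).Nonempty := mem_closure_iff.mp hcl V hV hx
  have hpos := (hV.inter isOpen_Ioo).measure_pos (volume : Measure ℝ) hVo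
  rw [unitInterval.volume_apply]
  refine (hpos.trans_le (measure_mono ?_)).ne'
  rintro y ⟨hy, h0, h1⟩
  exact ⟨⟨y, h0.le, h1.le⟩, hy, rfl⟩

/-- The inclusion of the circle into the unit interval as the interval `(0,1]`. -/
noncomputable def circleToInterval (t : AddCircle (1 : ℝ)) : unitInterval :=
  ⟨(AddCircle.equivIoc 1 0 t : ℝ), (AddCircle.equivIoc 1 0 t).2.1.le,
    by simpa using (AddCircle.equivIoc 1 0 t).2.2⟩

lemma coe_circleToInterval_coe {r : ℝ} (h : r ∈ Ioc (0 : ℝ) 1) :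
    (circleToInterval (r : AddCircle (1 : ℝ)) : ℝ) = r := by
  have h' : r ∈ Ioc (0 : ℝ) (0 + 1) := by simpa using h
  simp only [circleToInterval, AddCircle.equivIoc_coe_eq h']

lemma measurePreserving_circleToInterval :
    MeasurePreserving circleToInterval volume volume := by
  have hpi := AddCircle.measurePreserving_equivIoc (T := 1) (a := 0)
  have hm : Measurable circleToInterval :=
    Measurable.subtype_mk (measurable_subtype_coe.comp hpi.measurable)
  refine ⟨hm, ?_⟩
  have hcoe : MeasurePreserving (Subtype.val : Ioc (0 : ℝ) (0 + 1) → ℝ)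
      (Measure.comap Subtype.val volume) (volume.restrict (Ioc (0 : ℝ) (0 + 1))) :=
    measurePreserving_subtype_coe measurableSet_Ioc
  have h1 := (hcoe.comp hpi).map_eq
  have h2 := unitInterval.measurePreserving_coe.map_eq
  have h3 : Measure.map ((↑) : unitInterval → ℝ) (Measure.map circleToInterval volume) =
      Measure.map ((↑) : unitInterval → ℝ) volume := by
    rw [Measure.map_map measurable_subtype_coe hm, h2]
    refine h1.trans ?_
    rw [zero_add]
    exact restrict_Ioc_eq_restrict_Icc
  have := congrArg (Measure.comap ((↑) : unitInterval → ℝ)) h3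
  rwa [unitInterval.measurableEmbedding_coe.comap_map,
    unitInterval.measurableEmbedding_coe.comap_map] at this

/-- Ergodicity is inherited from doubling on the circle. With `(0,1]` as fundamental domain the
semiconjugacy holds at every point: `1/2` goes to `1` and `1` to `1` on both sides. -/
lemma ergodic_baseMap : Ergodic baseMap volume := by
  have : Fact ((0 : ℝ) < 1) := ⟨zero_lt_one⟩
  refine measurePreserving_circleToInterval.ergodic_of_ergodic_semiconj
    (AddCircle.ergodic_nsmul (T := 1) (n := 2) one_lt_two) measurable_baseMap (fun t => ?_)
  obtain ⟨r, hr, rfl⟩ : ∃ r ∈ Ioc (0 : ℝ) 1, (r : AddCircle (1 : ℝ)) = t := by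
    refine ⟨(AddCircle.equivIoc 1 0 t : ℝ), by simpa using (AddCircle.equivIoc 1 0 t).2, ?_⟩
    exact (AddCircle.equivIoc 1 0).symm_apply_apply t
  apply Subtype.ext
  change (circleToInterval ((2 : ℕ) • (r : AddCircle (1 : ℝ))) : ℝ) =
    (baseMap (circleToInterval r) : ℝ)
  by_cases h : r ≤ 1 / 2
  · rw [coe_baseMap_of_le (by rwa [coe_circleToInterval_coe hr]), coe_circleToInterval_coe hr,
      ← AddCircle.coe_nsmul, nsmul_eq_mul, coe_circleToInterval_coe]
    · norm_num
    · constructor <;> push_cast <;> linarith [hr.1]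
  · have h := not_le.mp h
    rw [coe_baseMap_of_lt (by rwa [coe_circleToInterval_coe hr]), coe_circleToInterval_coe hr,
      ← AddCircle.coe_nsmul, nsmul_eq_mul,
      show (((2 : ℕ) * r : ℝ) : AddCircle (1 : ℝ)) = ((2 * r - 1 : ℝ) : AddCircle (1 : ℝ)) by
        rw [AddCircle.coe_sub, AddCircle.coe_period]; simp,
      coe_circleToInterval_coe]
    constructor <;> linarith [hr.2]

/-- Almost every orbit of the doubling map accumulates at every point. -/
lemma ae_forall_mapClusterPt_baseMap :
    ∀ᵐ x : unitInterval, ∀ a, MapClusterPt a atTop (fun n : ℕ => baseMap^[n] x) := by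
  have key : ∀ U : Set unitInterval, IsOpen U → U.Nonempty →
      ∀ᵐ x : unitInterval, ∃ᶠ n in atTop, baseMap^[n] x ∈ U := by
    intro U hU hne
    -- `S` is strictly invariant, so it is null or full by ergodicity; Poincaré recurrence puts
    -- almost all of `U` in `S`, which rules out null.
    set S : Set unitInterval := {x | ∃ᶠ n in atTop, baseMap^[n] x ∈ U} with hS
    have hinv : baseMap ⁻¹' S = S := by
      ext x
      simp only [hS, mem_preimage, mem_ofPred_eq, ← Function.iterate_succ_apply]
      exact Filter.frequently_map (m := (· + 1)) (P := fun n => baseMap^[n] x ∈ U) |>.symm.trans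
        (by rw [map_add_atTop_eq_nat])
    have hmeas : MeasurableSet S := by
      have : S = limsup (fun n => baseMap^[n] ⁻¹' U) atTop := by
        ext x; rw [mem_limsup_iff_frequently_mem]; rfl
      rw [this]
      exact MeasurableSet.measurableSet_limsup
        fun n => (measurable_baseMap.iterate n) hU.measurableSet
    have hcons := ergodic_baseMap.toMeasurePreserving.conservative.ae_mem_imp_frequently_image_mem
      hU.measurableSet.nullMeasurableSet
    rcases ergodic_baseMap.toPreErgodic.ae_mem_or_ae_notMem hmeas hinv with h | h
    · exact h
    · exfalso
      have h0 : volume U = 0 := by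
        rw [measure_eq_zero_iff_ae_notMem]
        filter_upwards [h, hcons] with x hx hx' hxU using hx (hx' hxU)
      exact (hU.measure_pos volume hne).ne' h0
  have hB := TopologicalSpace.isBasis_countableBasis unitInterval
  have hall : ∀ᵐ x : unitInterval, ∀ U ∈ TopologicalSpace.countableBasis unitInterval,
      ∃ᶠ n in atTop, baseMap^[n] x ∈ U :=
    (ae_ball_iff (TopologicalSpace.countable_countableBasis _)).mpr fun U hU =>
      key U (hB.isOpen hU) (TopologicalSpace.nonempty_of_mem_countableBasis hU)
  filter_upwards [hall] with x hx a
  rw [mapClusterPt_iff_frequently]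
  intro s hs
  obtain ⟨U, hU, haU, hUs⟩ := hB.mem_nhds_iff.mp hs
  exact (hx U hU).mono fun n hn => hUs hn

/-! ### Exponential moments and Lyapunov functions for random iteration -/

/-- From `exp t ≤ 1 + t + t²` for `|t| ≤ 1`: the linear terms gain `s c / 2` and, for this `s`, the
quadratic ones cost at most `s c / 4`. A negative mean of logarithms thus becomes a contracted
moment, with `s` and `ρ` depending only on `K` and `c`. -/
lemma exists_exp_avg_le {K c : ℝ} (hK : 0 < K) (hc : 0 < c) :
    ∃ s ρ : ℝ, 0 < s ∧ 0 ≤ ρ ∧ ρ < 1 ∧ ∀ a b : ℝ, |a| ≤ K → |b| ≤ K → a + b ≤ -c →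
      (Real.exp (s * a) + Real.exp (s * b)) / 2 ≤ ρ := by
  set s : ℝ := min (1 / K) (c / (4 * K ^ 2)) with hs
  have hs0 : 0 < s := by positivity
  have hs1 : s * K ≤ 1 := by
    calc s * K ≤ 1 / K * K := by gcongr; exact min_le_left _ _
      _ = 1 := by field_simp
  have hs2 : s * K ^ 2 ≤ c / 4 := by
    calc s * K ^ 2 ≤ c / (4 * K ^ 2) * K ^ 2 := by gcongr; exact min_le_right _ _
      _ = c / 4 := by field_simp
  have hexp : ∀ a : ℝ, |a| ≤ K → Real.exp (s * a) ≤ 1 + s * a + s * (s * K ^ 2) := by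
    intro a ha
    have h1 : |s * a| ≤ 1 := by
      rw [abs_mul, abs_of_pos hs0]
      exact (mul_le_mul_of_nonneg_left ha hs0.le).trans hs1
    have h2 := Real.abs_exp_sub_one_sub_id_le h1
    have h3 : a ^ 2 ≤ K ^ 2 := sq_le_sq' (abs_le.mp ha).1 (abs_le.mp ha).2
    have h4 := (abs_le.mp h2).2
    nlinarith [mul_le_mul_of_nonneg_left h3 (sq_nonneg s)]
  refine ⟨s, max 0 (1 - s * c / 4), hs0, le_max_left _ _, max_lt one_pos ?_, ?_⟩
  · have := mul_pos hs0 hc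
    linarith
  · intro a b ha hb hab
    refine le_max_of_le_right ?_
    have h1 := hexp a ha
    have h2 := hexp b hb
    have h3 := mul_le_mul_of_nonneg_left hs2 hs0.le
    have h4 := mul_le_mul_of_nonneg_left hab hs0.le
    nlinarith

/-- The skew product over the doubling map with fiber maps `g₁` and `g₂`. -/
noncomputable def skewProduct {Y : Type*} (g₁ g₂ : Y → Y) (z : unitInterval × Y) :
    unitInterval × Y :=
  (baseMap z.1, if (z.1 : ℝ) ≤ 1 / 2 then g₁ z.2 else g₂ z.2)

section skewProduct

variable {Y : Type*} {g₁ g₂ : Y → Y}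

lemma fst_iterate_skewProduct (n : ℕ) (z : unitInterval × Y) :
    ((skewProduct g₁ g₂)^[n] z).1 = baseMap^[n] z.1 := by
  induction n generalizing z with
  | zero => rfl
  | succ n ih => rw [Function.iterate_succ_apply, ih, Function.iterate_succ_apply]; rfl

lemma skewProduct_of_le {x : unitInterval} (h : (x : ℝ) ≤ 1 / 2) (y : Y) :
    skewProduct g₁ g₂ (x, y) = (baseMap x, g₁ y) := by
  simp only [skewProduct, h, if_true]

lemma skewProduct_of_lt {x : unitInterval} (h : ¬ (x : ℝ) ≤ 1 / 2) (y : Y) :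
    skewProduct g₁ g₂ (x, y) = (baseMap x, g₂ y) := by
  simp only [skewProduct, h, if_false]

/-- The function `W` along the orbit, killed when `W` exceeds `1`. -/
noncomputable def killedValue (g₁ g₂ : Y → Y) (W : Y → ENNReal) :
    ℕ → unitInterval × Y → ENNReal
  | 0, z => W z.2
  | n + 1, z => {z : unitInterval × Y | W z.2 ≤ 1}.indicator
      (fun z => killedValue g₁ g₂ W n (skewProduct g₁ g₂ z)) z

variable {W : Y → ENNReal}

/-- The first value above `1` is still recorded and only later ones are zeroed. Hence if all
recorded values are below `1`, nothing was ever killed. -/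
lemma killedValue_eq_of_forall_lt (z : unitInterval × Y)
    (h : ∀ n, killedValue g₁ g₂ W n z < 1) (n : ℕ) :
    killedValue g₁ g₂ W n z = W ((skewProduct g₁ g₂)^[n] z).2 := by
  have key : ∀ n z, (∀ k ≤ n, killedValue g₁ g₂ W k z < 1) →
      killedValue g₁ g₂ W n z = W ((skewProduct g₁ g₂)^[n] z).2 := by
    intro n
    induction n with
    | zero => intro z _; rfl
    | succ n ih =>
      intro z hz
      have hz0 : W z.2 ≤ 1 := (hz 0 (Nat.zero_le _)).le
      have hs : ∀ k, killedValue g₁ g₂ W (k + 1) z =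
          killedValue g₁ g₂ W k (skewProduct g₁ g₂ z) := fun k => by
        simp only [killedValue]
        exact indicator_of_mem (by exact hz0) _
      rw [hs, Function.iterate_succ_apply]
      exact ih _ fun k hk => by rw [← hs]; exact hz _ (Nat.succ_le_succ hk)
  exact key n z fun k _ => h k

variable [MeasurableSpace Y]

lemma measurable_skewProduct (h₁ : Measurable g₁) (h₂ : Measurable g₂) :
    Measurable (skewProduct g₁ g₂) :=
  (measurable_baseMap.comp measurable_fst).prodMk
    (Measurable.ite (measurable_fst measurableSet_le_half) (h₁.comp measurable_snd)
      (h₂.comp measurable_snd))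

lemma lintegral_comp_skewProduct {H : unitInterval × Y → ENNReal} (hH : Measurable H) (y : Y) :
    ∫⁻ x, H (skewProduct g₁ g₂ (x, y)) =
      2⁻¹ * ((∫⁻ x, H (x, g₁ y)) + ∫⁻ x, H (x, g₂ y)) := by
  rw [← lintegral_branch (H₁ := fun x => H (x, g₁ y)) (H₂ := fun x => H (x, g₂ y))
    (hH.comp measurable_prodMk_right) (hH.comp measurable_prodMk_right)]
  refine lintegral_congr fun x => ?_
  by_cases h : (x : ℝ) ≤ 1 / 2
  · rw [skewProduct_of_le h, if_pos h]
  · rw [skewProduct_of_lt h, if_neg h]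

lemma measurable_killedValue (h₁ : Measurable g₁) (h₂ : Measurable g₂) (hW : Measurable W)
    (n : ℕ) : Measurable (killedValue g₁ g₂ W n) := by
  induction n with
  | zero => exact hW.comp measurable_snd
  | succ n ih =>
    exact (ih.comp (measurable_skewProduct h₁ h₂)).indicator
      (measurableSet_le (hW.comp measurable_snd) measurable_const)

/-- Killing makes the drift inequality on `W ≤ 1` sufficient for geometric decay of the mean. The
induction peels off the first step, so that `lintegral_comp_skewProduct` applies with the new
heights. -/
lemma lintegral_killedValue_le (h₁ : Measurable g₁) (h₂ : Measurable g₂) (hW : Measurable W)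
    {ρ : ENNReal} (hle : ∀ y, W y ≤ 1 → 2⁻¹ * (W (g₁ y) + W (g₂ y)) ≤ ρ * W y) (n : ℕ) (y : Y) :
    ∫⁻ x, killedValue g₁ g₂ W n (x, y) ≤ ρ ^ n * W y := by
  induction n generalizing y with
  | zero => simp [killedValue]
  | succ n ih =>
    by_cases hy : W y ≤ 1
    · have : ∀ x : unitInterval, killedValue g₁ g₂ W (n + 1) (x, y) =
          killedValue g₁ g₂ W n (skewProduct g₁ g₂ (x, y)) := fun x => by
        simp only [killedValue]
        exact indicator_of_mem (by exact hy) _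
      simp_rw [this]
      rw [lintegral_comp_skewProduct (measurable_killedValue h₁ h₂ hW n)]
      calc _ ≤ 2⁻¹ * (ρ ^ n * W (g₁ y) + ρ ^ n * W (g₂ y)) := by gcongr <;> exact ih _
        _ = ρ ^ n * (2⁻¹ * (W (g₁ y) + W (g₂ y))) := by ring
        _ ≤ ρ ^ n * (ρ * W y) := mul_le_mul_right (hle y hy) _
        _ = _ := by ring
    · have : ∀ x : unitInterval, killedValue g₁ g₂ W (n + 1) (x, y) = 0 := fun x => by
        simp only [killedValue]
        exact indicator_of_notMem (by exact hy) _
      simp [this]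

/-- A Lyapunov function that decreases on average where it is at most `1` tends to zero along the
orbit with a probability that is close to one if its initial value is small. -/
lemma volume_not_tendsto_le (h₁ : Measurable g₁) (h₂ : Measurable g₂) (hW : Measurable W)
    {ρ : ENNReal} (hle : ∀ y, W y ≤ 1 → 2⁻¹ * (W (g₁ y) + W (g₂ y)) ≤ ρ * W y) (y : Y) :
    volume {x : unitInterval | ¬ Tendsto (fun n => W ((skewProduct g₁ g₂)^[n] (x, y)).2) atTop
      (𝓝 0)} ≤ (1 - ρ)⁻¹ * W y := by
  have hm : ∀ n, Measurable fun x : unitInterval => killedValue g₁ g₂ W n (x, y) := fun n =>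
    (measurable_killedValue h₁ h₂ hW n).comp measurable_prodMk_right
  -- If the sum is below `1`, no value reaches `1`, the orbit is never killed, and summability
  -- forces `W → 0`. Markov's inequality bounds the remaining event.
  calc _ ≤ volume {x : unitInterval | 1 ≤ ∑' n, killedValue g₁ g₂ W n (x, y)} := by
        refine measure_mono fun x hx => ?_
        simp only [mem_ofPred_eq] at hx ⊢
        by_contra! hlt
        refine hx ?_
        have hn := killedValue_eq_of_forall_lt (x, y) fun n => (ENNReal.le_tsum n).trans_lt hlt
        simp_rw [← hn]
        exact ENNReal.tendsto_atTop_zero_of_tsum_ne_top hlt.ne_top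
    _ ≤ ∫⁻ x, ∑' n, killedValue g₁ g₂ W n (x, y) := by
        simpa using mul_meas_ge_le_lintegral (μ := (volume : Measure unitInterval))
          (Measurable.tsum hm) 1
    _ = ∑' n, ∫⁻ x, killedValue g₁ g₂ W n (x, y) := lintegral_tsum fun n => (hm n).aemeasurable
    _ ≤ ∑' n, ρ ^ n * W y := ENNReal.tsum_le_tsum fun n => lintegral_killedValue_le h₁ h₂ hW hle n y
    _ = _ := by rw [ENNReal.tsum_mul_right, ENNReal.tsum_geometric]

/-- A Lyapunov function that decreases on average everywhere tends to zero along almost every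
orbit. -/
lemma ae_tendsto_zero_of_lyapunov (h₁ : Measurable g₁) (h₂ : Measurable g₂) (hW : Measurable W)
    {ρ : ENNReal} (hρ : ρ < 1) (hle : ∀ y, 2⁻¹ * (W (g₁ y) + W (g₂ y)) ≤ ρ * W y)
    {y : Y} (hy : W y ≠ ⊤) :
    ∀ᵐ x : unitInterval, Tendsto (fun n => W ((skewProduct g₁ g₂)^[n] (x, y)).2) atTop (𝓝 0) := by
  have hm : ∀ n, Measurable fun z : unitInterval × Y => W ((skewProduct g₁ g₂)^[n] z).2 := fun n =>
    hW.comp (measurable_snd.comp ((measurable_skewProduct h₁ h₂).iterate n))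
  have hint : ∀ n y, ∫⁻ x, W ((skewProduct g₁ g₂)^[n] (x, y)).2 ≤ ρ ^ n * W y := by
    intro n
    induction n with
    | zero => intro y; simp
    | succ n ih =>
      intro y
      simp_rw [Function.iterate_succ_apply]
      rw [lintegral_comp_skewProduct (H := fun z => W ((skewProduct g₁ g₂)^[n] z).2) (hm n)]
      calc _ ≤ 2⁻¹ * (ρ ^ n * W (g₁ y) + ρ ^ n * W (g₂ y)) := by gcongr <;> exact ih _
        _ = ρ ^ n * (2⁻¹ * (W (g₁ y) + W (g₂ y))) := by ring
        _ ≤ ρ ^ n * (ρ * W y) := mul_le_mul_right (hle y) _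
        _ = _ := by ring
  have hm' : ∀ n, Measurable fun x : unitInterval => W ((skewProduct g₁ g₂)^[n] (x, y)).2 :=
    fun n => (hm n).comp measurable_prodMk_right
  have hfin : ∫⁻ x, ∑' n, W ((skewProduct g₁ g₂)^[n] (x, y)).2 ≠ ⊤ := by
    rw [lintegral_tsum fun n => (hm' n).aemeasurable]
    refine ne_top_of_le_ne_top ?_ (ENNReal.tsum_le_tsum fun n => hint n y)
    rw [ENNReal.tsum_mul_right, ENNReal.tsum_geometric]
    exact ENNReal.mul_ne_top (ENNReal.inv_ne_top.mpr (tsub_pos_of_lt hρ).ne') hy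
  filter_upwards [ae_lt_top (Measurable.tsum hm') hfin] with x hx
  exact ENNReal.tendsto_atTop_zero_of_tsum_ne_top hx.ne

end skewProduct

/-- The law of large numbers for the digits of almost every point of the interval. -/
lemma ae_tendsto_average_digits (a b : ℝ) :
    ∀ᵐ x : unitInterval, Tendsto (fun n : ℕ => (1 / (n : ℝ)) *
      ∑ k ∈ Finset.range n, if (baseMap^[k] x : ℝ) ≤ 1 / 2 then a else b) atTop
        (𝓝 ((a + b) / 2)) := by
  set S : ℝ → ℝ → unitInterval → ℕ → ℝ := fun a b x n =>
    ∑ k ∈ Finset.range n, if (baseMap^[k] x : ℝ) ≤ 1 / 2 then a else b with hS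
  -- Digit sums are the fiber coordinate of a skew product of translations of the line, so the
  -- Lyapunov lemma applies with `W t = exp (s t)`.
  have hsnd : ∀ (a b : ℝ) (n : ℕ) (x : unitInterval) (t : ℝ),
      ((skewProduct (fun t : ℝ => t + a) (fun t => t + b))^[n] (x, t)).2 = t + S a b x n := by
    intro a b n
    induction n with
    | zero => intro x t; simp [hS]
    | succ n ih =>
      intro x t
      have : S a b x (n + 1) = (if (x : ℝ) ≤ 1 / 2 then a else b) + S a b (baseMap x) n := by
        simp only [hS]
        rw [Finset.sum_range_succ', add_comm]
        rfl
      rw [Function.iterate_succ_apply, this]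
      by_cases h : (x : ℝ) ≤ 1 / 2
      · rw [skewProduct_of_le h, ih, if_pos h]; ring
      · rw [skewProduct_of_lt h, ih, if_neg h]; ring
  have hneg : ∀ a b : ℝ, a + b < 0 → ∀ᵐ x : unitInterval, ∀ᶠ n in atTop, S a b x n < 0 := by
    intro a b hab
    obtain ⟨s, ρ, hs, hρ0, hρ1, h⟩ := exists_exp_avg_le (K := |a| + |b| + 1) (c := -(a + b))
      (by positivity) (by linarith)
    have hab' := h a b (by linarith [abs_nonneg b]) (by linarith [abs_nonneg a]) (by linarith)
    have := ae_tendsto_zero_of_lyapunov (Y := ℝ) (g₁ := fun t => t + a) (g₂ := fun t => t + b)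
      (W := fun t => ENNReal.ofReal (Real.exp (s * t))) (ρ := ENNReal.ofReal ρ) (by fun_prop)
      (by fun_prop) (by fun_prop) (by simpa using hρ1) (fun t => ?_) (y := 0) (by simp)
    · filter_upwards [this] with x hx
      have h1 : (0 : ENNReal) < 1 := one_pos
      filter_upwards [hx.eventually_lt_const h1] with n hn
      rw [hsnd, zero_add, ENNReal.ofReal_lt_one, Real.exp_lt_one_iff] at hn
      by_contra! hc
      exact absurd hn (not_lt.mpr (mul_nonneg hs.le hc))
    · rw [← ENNReal.ofReal_add (by positivity) (by positivity), ← ENNReal.ofReal_mul hρ0,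
        ← ENNReal.ofReal_ofNat, ← ENNReal.ofReal_inv_of_pos two_pos,
        ← ENNReal.ofReal_mul (by norm_num)]
      refine ENNReal.ofReal_le_ofReal ?_
      rw [mul_add s, mul_add s, Real.exp_add, Real.exp_add]
      nlinarith [Real.exp_pos (s * t), mul_le_mul_of_nonneg_left hab' (Real.exp_pos (s * t)).le]
  have hshift : ∀ (a b c : ℝ) (x : unitInterval) (n : ℕ),
      S (a - c) (b - c) x n = S a b x n - n * c := by
    intro a b c x n
    simp only [hS]
    rw [← nsmul_eq_mul, ← Finset.card_range n, ← Finset.sum_const, Finset.card_range,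
      ← Finset.sum_sub_distrib]
    refine Finset.sum_congr rfl fun k _ => ?_
    split_ifs <;> rfl
  have hopp : ∀ (a b : ℝ) (x : unitInterval) (n : ℕ), S (-a) (-b) x n = - S a b x n := by
    intro a b x n
    simp only [hS]
    rw [← Finset.sum_neg_distrib]
    refine Finset.sum_congr rfl fun k _ => ?_
    split_ifs <;> rfl
  -- Subtracting slightly more than the mean makes the digits negative on average. The matching
  -- lower bound is this one for `-a` and `-b`.
  have hup : ∀ a b : ℝ, ∀ᵐ x : unitInterval, ∀ m : ℕ, ∀ᶠ n : ℕ in atTop,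
      S a b x n < n * ((a + b) / 2 + 1 / (m + 1)) := by
    intro a b
    rw [ae_all_iff]
    intro m
    have hm : (0 : ℝ) < 1 / (m + 1) := by positivity
    filter_upwards [hneg (a - ((a + b) / 2 + 1 / (m + 1))) (b - ((a + b) / 2 + 1 / (m + 1)))
      (by linarith)] with x hx
    filter_upwards [hx] with n hn
    rw [hshift] at hn
    linarith
  filter_upwards [hup a b, hup (-a) (-b)] with x hx hx'
  rw [Metric.tendsto_atTop']
  intro ε hε
  obtain ⟨m, hm⟩ := exists_nat_one_div_lt hε
  obtain ⟨N, hN⟩ := eventually_atTop.mp ((hx m).and ((hx' m).and (eventually_gt_atTop 0)))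
  refine ⟨N, fun n hn => ?_⟩
  obtain ⟨h1, h2, h3⟩ := hN n hn.le
  have hn0 : (0 : ℝ) < n := by exact_mod_cast h3
  rw [hopp] at h2
  change |1 / (n : ℝ) * S a b x n - (a + b) / 2| < ε
  have e : S a b x n = n * (1 / (n : ℝ) * S a b x n) := by field_simp
  set q := 1 / (n : ℝ) * S a b x n
  rw [e] at h1 h2
  have h1' := lt_of_mul_lt_mul_left h1 hn0.le
  have h2' : -q < (-a + -b) / 2 + 1 / (m + 1) := by
    refine lt_of_mul_lt_mul_left ?_ hn0.le
    linarith
  rw [abs_lt]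
  constructor <;> linarith

/-! ### Invariant segments of skew products of the square -/

lemma isClosed_lineAt (j : unitInterval) : IsClosed (lineAt j) :=
  isClosed_eq continuous_snd continuous_const

lemma isCompact_lineAt (j : unitInterval) : IsCompact (lineAt j) :=
  (isClosed_lineAt j).isCompact

/-- By compactness, an orbit that returns infinitely often outside a neighbourhood of the line
accumulates off it. -/
lemma mem_basin_lineAt {F : Square → Square} {j : unitInterval} {z : Square} :
    z ∈ basin F (lineAt j) ↔ Tendsto (fun n => (F^[n] z).2) atTop (𝓝 j) := by
  constructor
  · intro h
    by_contra hn
    rw [tendsto_nhds] at hn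
    push Not at hn
    obtain ⟨V, hV, hj, hev⟩ := hn
    have hfr : ∃ᶠ n in atTop, F^[n] z ∈ {w : Square | w.2 ∉ V} := not_eventually.mp hev
    have hcl : IsClosed {w : Square | w.2 ∉ V} :=
      (hV.preimage continuous_snd).isClosed_compl
    obtain ⟨w, hw, hcw⟩ := hcl.isCompact.exists_mapClusterPt_of_frequently hfr
    have hwj : w.2 = j := h hcw
    exact hw (hwj ▸ hj)
  · intro h w hw
    have h2 : MapClusterPt w.2 atTop (fun n => (F^[n] z).2) :=
      hw.tendsto_comp (continuous_snd.tendsto w)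
    exact (tendsto_nhds_unique_of_frequently_eq
      (f := fun _ : unitInterval => w.2) (g := fun _ : unitInterval => j) (a := w.2) (b := j)
      (l := 𝓝 w.2) tendsto_const_nhds tendsto_const_nhds <| by
        by_contra hne
        rw [not_frequently] at hne
        have hne' : w.2 ≠ j := hne.self_of_nhds
        exact hne' (eq_of_nhds_neBot (h2.neBot.mono (inf_le_inf_left _ h))))

lemma measurableSet_basin_lineAt {F : Square → Square} (hF : Measurable F) (j : unitInterval) :
    MeasurableSet (basin F (lineAt j)) := by
  have : basin F (lineAt j) = {z | Tendsto (fun n => (F^[n] z).2) atTop (𝓝 j)} := by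
    ext z; exact mem_basin_lineAt
  rw [this]
  exact measurableSet_tendsto _ fun n => measurable_snd.comp (hF.iterate n)

lemma map_mem_basin_lineAt_iff {F : Square → Square} {j : unitInterval} {z : Square} :
    F z ∈ basin F (lineAt j) ↔ z ∈ basin F (lineAt j) := by
  rw [mem_basin_lineAt, mem_basin_lineAt, ← tendsto_add_atTop_iff_nat (f := fun n => (F^[n] z).2) 1]
  simp only [Function.iterate_succ_apply]

lemma surjective_baseMap : Function.Surjective baseMap := by
  intro a
  have h : ((⟨(a : ℝ) / 2, by constructor <;> linarith [a.2.1, a.2.2]⟩ : unitInterval) : ℝ) ≤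
      1 / 2 := by
    simp only; linarith [a.2.2]
  exact ⟨_, Subtype.ext ((coe_baseMap_of_le h).trans (by ring))⟩

section Segment

variable {g₁ g₂ : unitInterval → unitInterval} {j : unitInterval}

lemma skewProduct_line (h₁ : g₁ j = j) (h₂ : g₂ j = j) (x : unitInterval) :
    skewProduct g₁ g₂ (x, j) = (baseMap x, j) := by
  simp only [skewProduct, h₁, h₂, ite_self]

lemma iterate_skewProduct_line (h₁ : g₁ j = j) (h₂ : g₂ j = j) (n : ℕ) (x : unitInterval) :
    (skewProduct g₁ g₂)^[n] (x, j) = (baseMap^[n] x, j) := by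
  induction n generalizing x with
  | zero => rfl
  | succ n ih => rw [Function.iterate_succ_apply, skewProduct_line h₁ h₂, ih]; rfl

lemma isCompactInvariant_lineAt (h₁ : g₁ j = j) (h₂ : g₂ j = j) :
    IsCompactInvariant (skewProduct g₁ g₂) (lineAt j) := by
  refine ⟨isCompact_lineAt j, Subset.antisymm ?_ ?_⟩
  · rintro _ ⟨⟨x, y⟩, rfl : y = j, rfl⟩
    rw [skewProduct_line h₁ h₂]
    rfl
  · rintro ⟨x, y⟩ (rfl : y = j)
    obtain ⟨x', rfl⟩ := surjective_baseMap x
    exact ⟨(x', y), rfl, skewProduct_line h₁ h₂ x'⟩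

lemma isAsymptoticallyStableIn_lineAt (h₁ : g₁ j = j) (h₂ : g₂ j = j) :
    IsAsymptoticallyStableIn (skewProduct g₁ g₂) (lineAt j) (lineAt j) := by
  refine ⟨isCompactInvariant_lineAt h₁ h₂, Subset.rfl, ?_, ?_, univ, univ_mem, ?_⟩
  · rintro ⟨x, y⟩ (rfl : y = j)
    rw [skewProduct_line h₁ h₂]
    rfl
  · rintro U hU
    refine ⟨U, hU, ?_⟩
    rintro ⟨x, y⟩ ⟨-, rfl : y = j⟩ n
    rw [iterate_skewProduct_line h₁ h₂]
    exact subset_of_mem_nhdsSet hU rfl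
  · rintro ⟨x, y⟩ ⟨-, rfl : y = j⟩
    rw [mem_basin_lineAt]
    simp only [iterate_skewProduct_line h₁ h₂]
    exact tendsto_const_nhds

/-- The base coordinate is frequently near any given point and the height is eventually near `j`, so
both happen together infinitely often. -/
lemma omegaSet_eq_lineAt {z : Square}
    (hx : ∀ a, MapClusterPt a atTop (fun n : ℕ => baseMap^[n] z.1))
    (hz : z ∈ basin (skewProduct g₁ g₂) (lineAt j)) :
    omegaSet (skewProduct g₁ g₂) z = lineAt j := by
  refine Subset.antisymm hz ?_
  rintro ⟨a, y⟩ (rfl : y = j)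
  rw [mem_basin_lineAt] at hz
  change MapClusterPt (a, y) atTop _
  rw [mapClusterPt_iff_frequently]
  intro s hs
  obtain ⟨u, hu, v, hv, huv⟩ := mem_nhds_prod_iff.mp hs
  refine (((mapClusterPt_iff_frequently.mp (hx a)) u hu).and_eventually
    (hz.eventually_mem hv)).mono ?_
  rintro n ⟨h1, h2⟩
  exact huv ⟨by rwa [fst_iterate_skewProduct], h2⟩

lemma isTransitiveSet_lineAt (h₁ : g₁ j = j) (h₂ : g₂ j = j) :
    IsTransitiveSet (skewProduct g₁ g₂) (lineAt j) := by
  obtain ⟨x, hx⟩ := ae_forall_mapClusterPt_baseMap.exists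
  refine ⟨(x, j), rfl, omegaSet_eq_lineAt hx ?_⟩
  rw [mem_basin_lineAt]
  simp only [iterate_skewProduct_line h₁ h₂]
  exact tendsto_const_nhds

lemma ae_fst {p : unitInterval → Prop} (h : ∀ᵐ x, p x) : ∀ᵐ z : Square, p z.1 :=
  Measure.quasiMeasurePreserving_fst.ae h

/-- Almost every point of the basin has the whole segment as its limit set, so a proper compact
subset has a null basin. -/
lemma isMilnorAttractor_lineAt (h₁ : g₁ j = j) (h₂ : g₂ j = j)
    (hpos : 0 < volume (basin (skewProduct g₁ g₂) (lineAt j))) :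
    IsMilnorAttractor (skewProduct g₁ g₂) (lineAt j) := by
  refine ⟨isCompactInvariant_lineAt h₁ h₂, hpos, ?_⟩
  rintro ⟨A', hA', -, heq⟩
  refine hpos.ne' ?_
  rw [← measure_congr heq, measure_eq_zero_iff_ae_notMem]
  filter_upwards [ae_fst ae_forall_mapClusterPt_baseMap] with z hz hzA
  have := omegaSet_eq_lineAt (j := j) hz (Subset.trans hzA hA'.subset)
  exact hA'.not_subset (this ▸ hzA)

/-- The length measure on a horizontal segment. -/
noncomputable def lineMeasure (j : unitInterval) : Measure Square :=
  (volume : Measure unitInterval).map (fun x => (x, j))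

lemma measurePreserving_lineMeasure (j : unitInterval) :
    MeasurePreserving (fun x : unitInterval => ((x, j) : Square)) volume (lineMeasure j) :=
  ⟨measurable_prodMk_right, rfl⟩

instance (j : unitInterval) : IsProbabilityMeasure (lineMeasure j) :=
  Measure.isProbabilityMeasure_map measurable_prodMk_right.aemeasurable

lemma ae_lineMeasure {p : Square → Prop} (h : ∀ᵐ x : unitInterval, p (x, j)) :
    ∀ᵐ z ∂lineMeasure j, p z :=
  (measurableEmbedding_prod_mk_right j).ae_map_iff.mpr h

lemma isErgodicMeasureOn_lineMeasure (hm₁ : Measurable g₁) (hm₂ : Measurable g₂)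
    (h₁ : g₁ j = j) (h₂ : g₂ j = j) :
    IsErgodicMeasureOn (skewProduct g₁ g₂) (lineAt j) (lineMeasure j) := by
  refine ⟨inferInstance, ?_, ?_⟩
  · exact (measurePreserving_lineMeasure j).ergodic_of_ergodic_semiconj ergodic_baseMap
      (measurable_skewProduct hm₁ hm₂) fun x => (skewProduct_line h₁ h₂ x).symm
  · exact ae_lineMeasure (ae_of_all _ fun x => rfl)

lemma isSRBMeasure_lineMeasure (hm₁ : Measurable g₁) (hm₂ : Measurable g₂)
    (h₁ : g₁ j = j) (h₂ : g₂ j = j) :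
    IsSRBMeasure (skewProduct g₁ g₂) j (lineAt j) (lineMeasure j) := by
  refine ⟨isErgodicMeasureOn_lineMeasure hm₁ hm₂ h₁ h₂, Subset.antisymm ?_ ?_,
    Measure.AbsolutelyContinuous.rfl⟩
  · exact Measure.support_subset_of_isClosed (isClosed_lineAt j)
      (ae_lineMeasure (ae_of_all _ fun x => rfl))
  · rintro ⟨x, y⟩ (rfl : y = j)
    rw [Measure.mem_support_iff_forall]
    intro U hU
    obtain ⟨V, hVU, hV, hxV⟩ := mem_nhds_iff.mp hU
    refine lt_of_lt_of_le ?_ (measure_mono hVU)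
    rw [lineMeasure, Measure.map_apply measurable_prodMk_right hV.measurableSet]
    exact (hV.preimage (by fun_prop)).measure_pos _ ⟨x, hxV⟩

lemma baseMap_zero : baseMap 0 = 0 := by
  apply Subtype.ext
  rw [coe_baseMap_of_le (by simp)]
  simp

/-- The fixed point of the base provides the second ergodic measure, which refutes unique
ergodicity. -/
lemma isErgodicMeasureOn_dirac (hm₁ : Measurable g₁) (hm₂ : Measurable g₂)
    (h₁ : g₁ j = j) (h₂ : g₂ j = j) :
    IsErgodicMeasureOn (skewProduct g₁ g₂) (lineAt j) (Measure.dirac (0, j)) := by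
  refine ⟨inferInstance, ⟨⟨measurable_skewProduct hm₁ hm₂, ?_⟩, ⟨fun s _ _ => ?_⟩⟩, ?_⟩
  · rw [Measure.map_dirac' (measurable_skewProduct hm₁ hm₂), skewProduct_line h₁ h₂, baseMap_zero]
  · rw [ae_dirac_eq]
    exact subsingleton_pure.map _
  · rw [Measure.dirac_apply' _ (isClosed_lineAt j).measurableSet.compl]
    simp [lineAt]

lemma dirac_ne_lineMeasure (j : unitInterval) :
    Measure.dirac ((0, j) : Square) ≠ lineMeasure j := by
  intro h
  have h1 := congrArg (fun μ => μ {((0, j) : Square)}) h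
  simp only [Measure.dirac_apply_of_mem (mem_singleton _)] at h1
  rw [lineMeasure, Measure.map_apply measurable_prodMk_right (measurableSet_singleton _)] at h1
  have : (fun x : unitInterval => ((x, j) : Square)) ⁻¹' {(0, j)} = {0} := by
    ext x; simp
  rw [this, measure_singleton] at h1
  exact one_ne_zero h1

lemma thickening_lineAt {δ : ℝ} (hδ : 0 < δ) :
    Metric.thickening δ (lineAt j) = univ ×ˢ Metric.ball j δ := by
  ext ⟨x, y⟩
  simp only [Metric.mem_thickening_iff, mem_prod, mem_univ, true_and, Metric.mem_ball]
  constructor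
  · rintro ⟨⟨x', y'⟩, rfl : y' = j, h⟩
    exact (le_max_right _ _).trans_lt h
  · intro h
    refine ⟨(x, j), rfl, ?_⟩
    rw [Prod.dist_eq, dist_self]
    exact max_lt hδ h

lemma isEssentialAttractor_lineAt (hm₁ : Measurable g₁) (hm₂ : Measurable g₂)
    (h₁ : g₁ j = j) (h₂ : g₂ j = j)
    (h : Tendsto (fun y => volume {x : unitInterval |
      (x, y) ∉ basin (skewProduct g₁ g₂) (lineAt j)}) (𝓝 j) (𝓝 0)) :
    IsEssentialAttractor (skewProduct g₁ g₂) (lineAt j) := by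
  refine ⟨isCompactInvariant_lineAt h₁ h₂, ?_⟩
  set B := basin (skewProduct g₁ g₂) (lineAt j) with hB
  have hBm : MeasurableSet B := measurableSet_basin_lineAt (measurable_skewProduct hm₁ hm₂) j
  rw [ENNReal.tendsto_nhds ENNReal.one_ne_top]
  intro ε hε
  obtain ⟨δ₀, hδ₀, hsub⟩ := Metric.eventually_nhds_iff_ball.mp
    (h.eventually_le_const hε)
  filter_upwards [Ioo_mem_nhdsGT hδ₀] with δ hδ
  set t := Metric.thickening δ (lineAt j) with ht
  have htm : MeasurableSet t := Metric.isOpen_thickening.measurableSet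
  have htv : t = univ ×ˢ Metric.ball j δ := thickening_lineAt hδ.1
  -- Fubini over heights: the tube is a product, and each of its horizontal slices misses the basin
  -- in measure at most `ε`.
  have hbad : volume (t \ B) ≤ ε * volume t := by
    rw [Measure.volume_eq_prod, Measure.prod_apply_symm (htm.diff hBm)]
    calc _ ≤ ∫⁻ y, (Metric.ball j δ).indicator (fun _ => ε) y := by
          refine lintegral_mono fun y => ?_
          by_cases hy : y ∈ Metric.ball j δ
          · rw [indicator_of_mem hy]
            refine (measure_mono ?_).trans (hsub y (Metric.ball_subset_ball hδ.2.le hy))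
            intro x hx
            exact hx.2
          · rw [indicator_of_notMem hy, nonpos_iff_eq_zero]
            convert! measure_empty (μ := (volume : Measure unitInterval))
            rw [htv, eq_empty_iff_forall_notMem]
            intro x hx
            exact hy hx.1.2
      _ = ε * volume (Metric.ball j δ) := by
          rw [lintegral_indicator Metric.isOpen_ball.measurableSet, setLIntegral_const]
      _ = _ := by rw [htv, Measure.prod_prod, measure_univ, one_mul]
  have ht0 : volume t ≠ 0 := by
    refine (Metric.isOpen_thickening.measure_pos _ ⟨(0, j), ?_⟩).ne'
    exact Metric.self_subset_thickening hδ.1 _ rfl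
  have httop : volume t ≠ ⊤ := measure_ne_top _ _
  constructor
  · rw [tsub_le_iff_right]
    rw [← ENNReal.mul_le_mul_iff_left ht0 httop, add_mul, ENNReal.div_mul_cancel ht0 httop, one_mul]
    calc volume t = volume (t ∩ B) + volume (t \ B) := (measure_inter_add_sdiff _ hBm).symm
      _ ≤ _ := by gcongr
  · refine (ENNReal.div_le_of_le_mul ?_).trans le_self_add
    rw [one_mul]
    exact measure_mono inter_subset_left

lemma IsEssentialAttractor.volume_basin_pos {F : Square → Square} {A : Set Square}
    (h : IsEssentialAttractor F A) : 0 < volume (basin F A) := by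
  have h1 : (0 : ENNReal) < 1 := one_pos
  obtain ⟨δ, hδ⟩ := (h.2.eventually_const_lt h1).exists
  rw [pos_iff_ne_zero]
  intro h0
  rw [measure_inter_null_of_null_right _ h0, ENNReal.zero_div] at hδ
  exact lt_irrefl _ hδ

end Segment

/-! ### Derivatives of iterates along an invariant segment -/

/-- A self-map of the square, extended to the plane by the projection onto the square. -/
noncomputable def squareExtend (F : Square → Square) (w : ℝ × ℝ) : ℝ × ℝ :=
  (((F (projIcc 0 1 zero_le_one w.1, projIcc 0 1 zero_le_one w.2)).1 : ℝ),
    ((F (projIcc 0 1 zero_le_one w.1, projIcc 0 1 zero_le_one w.2)).2 : ℝ))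

lemma squareExtend_coe (F : Square → Square) (z : Square) :
    squareExtend F ((z.1 : ℝ), (z.2 : ℝ)) = (((F z).1 : ℝ), ((F z).2 : ℝ)) := by
  simp only [squareExtend, projIcc_val, Prod.mk.eta]

/-- The projection fixes points of the square, so extension respects composition; this gives the
chain rule for iterates. -/
lemma squareExtend_comp (F G : Square → Square) :
    squareExtend (F ∘ G) = squareExtend F ∘ squareExtend G := by
  funext w
  simp only [Function.comp, squareExtend, projIcc_val]

lemma mapsTo_squareExtend (F : Square → Square) (s : Set (ℝ × ℝ)) :
    MapsTo (squareExtend F) s (Icc (0 : ℝ) 1 ×ˢ Icc (0 : ℝ) 1) :=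
  fun _ _ => ⟨(F _).1.2, (F _).2.2⟩

/-- The linear map of the plane with diagonal matrix. -/
noncomputable def diagonalMap (a b : ℝ) : ℝ × ℝ →L[ℝ] ℝ × ℝ :=
  (a • ContinuousLinearMap.fst ℝ ℝ ℝ).prod (b • ContinuousLinearMap.snd ℝ ℝ ℝ)

lemma diagonalMap_apply (a b : ℝ) (v : ℝ × ℝ) : diagonalMap a b v = (a * v.1, b * v.2) := rfl

lemma diagonalMap_comp (a b a' b' : ℝ) :
    (diagonalMap a b).comp (diagonalMap a' b') = diagonalMap (a * a') (b * b') := by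
  ext <;> simp [diagonalMap_apply]

section Multiplier

variable {g₁ g₂ : unitInterval → unitInterval} {j : unitInterval} {d₁ d₂ : ℝ}

/-- Away from the jump at `1/2` the map coincides locally with one branch, whose derivative on the
segment is diagonal. -/
lemma hasFDerivWithinAt_squareExtend
    (hd₁ : HasDerivWithinAt (fun v : ℝ => (g₁ (projIcc 0 1 zero_le_one v) : ℝ)) d₁ (Icc 0 1) j)
    (hd₂ : HasDerivWithinAt (fun v : ℝ => (g₂ (projIcc 0 1 zero_le_one v) : ℝ)) d₂ (Icc 0 1) j)
    {x : unitInterval} (hx : (x : ℝ) ≠ 1 / 2) :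
    HasFDerivWithinAt (squareExtend (skewProduct g₁ g₂))
      (diagonalMap 2 (if (x : ℝ) ≤ 1 / 2 then d₁ else d₂))
      (Icc (0 : ℝ) 1 ×ˢ Icc (0 : ℝ) 1) ((x : ℝ), (j : ℝ)) := by
  have hfst : HasFDerivWithinAt (fun w : ℝ × ℝ => 2 * w.1)
      ((2 : ℝ) • ContinuousLinearMap.fst ℝ ℝ ℝ) (Icc (0 : ℝ) 1 ×ˢ Icc (0 : ℝ) 1)
      ((x : ℝ), (j : ℝ)) := hasFDerivWithinAt_fst.const_mul 2
  have hsnd : ∀ {g : ℝ → ℝ} {d : ℝ}, HasDerivWithinAt g d (Icc 0 1) j →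
      HasFDerivWithinAt (fun w : ℝ × ℝ => g w.2) (d • ContinuousLinearMap.snd ℝ ℝ ℝ)
        (Icc (0 : ℝ) 1 ×ˢ Icc (0 : ℝ) 1) ((x : ℝ), (j : ℝ)) := by
    intro g d hg
    exact hg.comp_hasFDerivWithinAt (f := Prod.snd) ((x : ℝ), (j : ℝ)) hasFDerivWithinAt_snd
      fun w hw => hw.2
  have hproj : ∀ w : ℝ × ℝ, w ∈ Icc (0 : ℝ) 1 ×ˢ Icc (0 : ℝ) 1 →
      ((projIcc 0 1 zero_le_one w.1 : unitInterval) : ℝ) = w.1 := fun w hw => by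
    rw [projIcc_of_mem _ hw.1]
  have hmem : (((x : ℝ), (j : ℝ)) : ℝ × ℝ) ∈ Icc (0 : ℝ) 1 ×ˢ Icc (0 : ℝ) 1 := ⟨x.2, j.2⟩
  rcases lt_or_gt_of_ne hx with h | h
  · rw [if_pos h.le]
    have heq : squareExtend (skewProduct g₁ g₂)
        =ᶠ[𝓝[Icc (0 : ℝ) 1 ×ˢ Icc (0 : ℝ) 1] ((x : ℝ), (j : ℝ))]
        fun w => (2 * w.1, (g₁ (projIcc 0 1 zero_le_one w.2) : ℝ)) := by
      have hev : ∀ᶠ w : ℝ × ℝ in 𝓝[Icc (0 : ℝ) 1 ×ˢ Icc (0 : ℝ) 1] ((x : ℝ), (j : ℝ)),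
          w.1 < 1 / 2 := nhdsWithin_le_nhds <| continuous_fst.continuousAt.eventually_lt_const h
      filter_upwards [hev, self_mem_nhdsWithin] with w hw hwS
      rw [squareExtend, skewProduct_of_le (by rw [hproj w hwS]; exact hw.le),
        coe_baseMap_of_le (by rw [hproj w hwS]; exact hw.le), hproj w hwS]
    exact (hfst.prodMk (hsnd hd₁)).congr_of_eventuallyEq heq (heq.eq_of_nhdsWithin hmem)
  · rw [if_neg (not_le.mpr h)]
    have heq : squareExtend (skewProduct g₁ g₂)
        =ᶠ[𝓝[Icc (0 : ℝ) 1 ×ˢ Icc (0 : ℝ) 1] ((x : ℝ), (j : ℝ))]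
        fun w => (2 * w.1 - 1, (g₂ (projIcc 0 1 zero_le_one w.2) : ℝ)) := by
      have hev : ∀ᶠ w : ℝ × ℝ in 𝓝[Icc (0 : ℝ) 1 ×ˢ Icc (0 : ℝ) 1] ((x : ℝ), (j : ℝ)),
          1 / 2 < w.1 := nhdsWithin_le_nhds <| continuous_fst.continuousAt.eventually_const_lt h
      filter_upwards [hev, self_mem_nhdsWithin] with w hw hwS
      rw [squareExtend, skewProduct_of_lt (by rw [hproj w hwS]; exact not_le.mpr hw),
        coe_baseMap_of_lt (by rw [hproj w hwS]; exact hw), hproj w hwS]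
    exact ((hfst.sub_const 1).prodMk (hsnd hd₂)).congr_of_eventuallyEq heq
      (heq.eq_of_nhdsWithin hmem)

lemma hasFDerivWithinAt_squareExtend_iterate (h₁ : g₁ j = j) (h₂ : g₂ j = j)
    (hd₁ : HasDerivWithinAt (fun v : ℝ => (g₁ (projIcc 0 1 zero_le_one v) : ℝ)) d₁ (Icc 0 1) j)
    (hd₂ : HasDerivWithinAt (fun v : ℝ => (g₂ (projIcc 0 1 zero_le_one v) : ℝ)) d₂ (Icc 0 1) j)
    (n : ℕ) {x : unitInterval} (hx : ∀ k, (baseMap^[k] x : ℝ) ≠ 1 / 2) :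
    HasFDerivWithinAt (squareExtend (skewProduct g₁ g₂)^[n])
      (diagonalMap (2 ^ n)
        (∏ k ∈ Finset.range n, if (baseMap^[k] x : ℝ) ≤ 1 / 2 then d₁ else d₂))
      (Icc (0 : ℝ) 1 ×ˢ Icc (0 : ℝ) 1) ((x : ℝ), (j : ℝ)) := by
  induction n generalizing x with
  | zero =>
    have hmem : (((x : ℝ), (j : ℝ)) : ℝ × ℝ) ∈ Icc (0 : ℝ) 1 ×ˢ Icc (0 : ℝ) 1 := ⟨x.2, j.2⟩
    have hid : diagonalMap (2 ^ 0) (∏ k ∈ Finset.range 0,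
        if (baseMap^[k] x : ℝ) ≤ 1 / 2 then d₁ else d₂) = ContinuousLinearMap.id ℝ (ℝ × ℝ) := by
      ext <;> simp [diagonalMap_apply]
    rw [hid]
    refine HasFDerivWithinAt.congr' (hasFDerivWithinAt_id _ _) (fun w hw => ?_) hmem
    simp only [squareExtend, Function.iterate_zero, id, projIcc_of_mem _ hw.1,
      projIcc_of_mem _ hw.2]
  | succ n ih =>
    have hx0 : (x : ℝ) ≠ 1 / 2 := hx 0
    have hx' : ∀ k, (baseMap^[k] (baseMap x) : ℝ) ≠ 1 / 2 := fun k => hx (k + 1)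
    have h1 := hasFDerivWithinAt_squareExtend hd₁ hd₂ hx0
    have h2 := ih hx'
    have hval : squareExtend (skewProduct g₁ g₂) ((x : ℝ), (j : ℝ)) =
        ((baseMap x : ℝ), (j : ℝ)) := by
      rw [squareExtend_coe _ (x, j), skewProduct_line h₁ h₂]
    rw [← hval] at h2
    have h3 := h2.comp _ h1 (mapsTo_squareExtend _ _)
    rw [diagonalMap_comp] at h3
    rw [Function.iterate_succ, squareExtend_comp, Finset.prod_range_succ', pow_succ]
    exact h3

lemma squareDeriv_iterate (h₁ : g₁ j = j) (h₂ : g₂ j = j)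
    (hd₁ : HasDerivWithinAt (fun v : ℝ => (g₁ (projIcc 0 1 zero_le_one v) : ℝ)) d₁ (Icc 0 1) j)
    (hd₂ : HasDerivWithinAt (fun v : ℝ => (g₂ (projIcc 0 1 zero_le_one v) : ℝ)) d₂ (Icc 0 1) j)
    (n : ℕ) {x : unitInterval} (hx : ∀ k, (baseMap^[k] x : ℝ) ≠ 1 / 2) :
    squareDeriv (skewProduct g₁ g₂)^[n] (x, j) = diagonalMap (2 ^ n)
      (∏ k ∈ Finset.range n, if (baseMap^[k] x : ℝ) ≤ 1 / 2 then d₁ else d₂) :=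
  (hasFDerivWithinAt_squareExtend_iterate h₁ h₂ hd₁ hd₂ n hx).fderivWithin
    (((uniqueDiffOn_Icc zero_lt_one).prod (uniqueDiffOn_Icc zero_lt_one)) _ ⟨x.2, j.2⟩)

lemma ae_forall_iterate_baseMap_ne :
    ∀ᵐ x : unitInterval, ∀ k, (baseMap^[k] x : ℝ) ≠ 1 / 2 := by
  rw [ae_all_iff]
  intro k
  have h : ∀ᵐ x : unitInterval, x ≠ ⟨1 / 2, by constructor <;> norm_num⟩ :=
    compl_mem_ae_iff.mpr (measure_singleton _)
  filter_upwards [(measurePreserving_baseMap.iterate k).quasiMeasurePreserving.ae h] with x hx hx'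
  exact hx (Subtype.ext hx')

/-- The normal derivative of an iterate is a product of factors selected by the digits; its
logarithm is a digit sum, covered by the law of large numbers. -/
lemma ae_hasNormalExponentAt (h₁ : g₁ j = j) (h₂ : g₂ j = j)
    (hd₁ : HasDerivWithinAt (fun v : ℝ => (g₁ (projIcc 0 1 zero_le_one v) : ℝ)) d₁ (Icc 0 1) j)
    (hd₂ : HasDerivWithinAt (fun v : ℝ => (g₂ (projIcc 0 1 zero_le_one v) : ℝ)) d₂ (Icc 0 1) j)
    (hpos₁ : 0 < d₁) (hpos₂ : 0 < d₂) :
    ∀ᵐ z ∂lineMeasure j, HasNormalExponentAt (skewProduct g₁ g₂) z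
      ((Real.log d₁ + Real.log d₂) / 2) := by
  refine ae_lineMeasure ?_
  filter_upwards [ae_forall_iterate_baseMap_ne,
    ae_tendsto_average_digits (Real.log d₁) (Real.log d₂)] with x hx hlim
  refine hlim.congr fun n => ?_
  rw [squareDeriv_iterate h₁ h₂ hd₁ hd₂ n hx, diagonalMap_apply, mul_one, Real.norm_eq_abs,
    Real.log_abs, Real.log_prod]
  · congr 1
    refine Finset.sum_congr rfl fun k _ => ?_
    split_ifs <;> rfl
  · intro k _
    split_ifs
    exacts [hpos₁.ne', hpos₂.ne']

lemma ae_hasLyapunovExponentAt (h₁ : g₁ j = j) (h₂ : g₂ j = j)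
    (hd₁ : HasDerivWithinAt (fun v : ℝ => (g₁ (projIcc 0 1 zero_le_one v) : ℝ)) d₁ (Icc 0 1) j)
    (hd₂ : HasDerivWithinAt (fun v : ℝ => (g₂ (projIcc 0 1 zero_le_one v) : ℝ)) d₂ (Icc 0 1) j) :
    ∀ᵐ z ∂lineMeasure j, HasLyapunovExponentAt (skewProduct g₁ g₂) z (1, 0) (Real.log 2) := by
  refine ae_lineMeasure ?_
  filter_upwards [ae_forall_iterate_baseMap_ne] with x hx
  refine tendsto_const_nhds.congr' ?_
  filter_upwards [eventually_gt_atTop 0] with n hn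
  have hn' : (n : ℝ) ≠ 0 := by exact_mod_cast hn.ne'
  rw [squareDeriv_iterate h₁ h₂ hd₁ hd₂ n hx, diagonalMap_apply, Prod.norm_mk]
  simp only [mul_one, mul_zero, norm_zero, norm_pow, Real.norm_ofNat]
  rw [max_eq_left (by positivity), Real.log_pow]
  field_simp

lemma isChaoticAttractor_lineAt (hm₁ : Measurable g₁) (hm₂ : Measurable g₂)
    (h₁ : g₁ j = j) (h₂ : g₂ j = j)
    (hd₁ : HasDerivWithinAt (fun v : ℝ => (g₁ (projIcc 0 1 zero_le_one v) : ℝ)) d₁ (Icc 0 1) j)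
    (hd₂ : HasDerivWithinAt (fun v : ℝ => (g₂ (projIcc 0 1 zero_le_one v) : ℝ)) d₂ (Icc 0 1) j)
    (hpos : 0 < volume (basin (skewProduct g₁ g₂) (lineAt j))) :
    IsChaoticAttractor (skewProduct g₁ g₂) (lineAt j) := by
  refine ⟨isMilnorAttractor_lineAt h₁ h₂ hpos, isTransitiveSet_lineAt h₁ h₂, lineMeasure j,
    isErgodicMeasureOn_lineMeasure hm₁ hm₂ h₁ h₂, ⟨Real.log 2, Real.log_pos one_lt_two, ?_⟩,
    Measure.dirac (0, j), isErgodicMeasureOn_dirac hm₁ hm₂ h₁ h₂, dirac_ne_lineMeasure j⟩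
  filter_upwards [ae_hasLyapunovExponentAt h₁ h₂ hd₁ hd₂] with z hz
  exact ⟨(1, 0), by simp, hz⟩

end Multiplier

/-! ### Random iteration near and between two invariant segments -/

lemma ENNReal.half_ofReal_add_le {a b c ρ : ℝ} (ha : 0 ≤ a) (hb : 0 ≤ b) (hρ : 0 ≤ ρ)
    (h : (a + b) / 2 ≤ ρ * c) :
    2⁻¹ * (ENNReal.ofReal a + ENNReal.ofReal b) ≤ ENNReal.ofReal ρ * ENNReal.ofReal c := by
  rw [← ENNReal.ofReal_add ha hb, ← ENNReal.ofReal_mul hρ, ← ENNReal.ofReal_ofNat,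
    ← ENNReal.ofReal_inv_of_pos two_pos, ← ENNReal.ofReal_mul (by norm_num)]
  exact ENNReal.ofReal_le_ofReal (by linarith)

lemma Real.rpow_mul_eq_mul_exp {q a s : ℝ} (hq : 0 ≤ q) (ha : 0 < a) :
    (q * a) ^ s = q ^ s * Real.exp (s * Real.log a) := by
  rw [Real.mul_rpow hq ha.le, Real.rpow_def_of_pos ha, mul_comm s]

section Fiber

variable {g₁ g₂ : unitInterval → unitInterval} {k : unitInterval}
  {A₁ A₂ B₁ B₂ : unitInterval → ℝ}

/-- By continuity the sum of the logarithmic factors stays below half its negative value at `k` on a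
small ball. There a small power of the distance contracts on average, and `volume_not_tendsto_le`
bounds the failure probability by a multiple of it. -/
lemma tendsto_volume_notMem_basin (hg₁ : Continuous g₁) (hg₂ : Continuous g₂)
    (hc₁ : ContinuousAt A₁ k) (hc₂ : ContinuousAt A₂ k)
    (hA₁ : ∀ y, 0 < A₁ y) (hA₂ : ∀ y, 0 < A₂ y)
    (h₁ : ∀ y, dist (g₁ y) k = dist y k * A₁ y) (h₂ : ∀ y, dist (g₂ y) k = dist y k * A₂ y)
    (hneg : Real.log (A₁ k) + Real.log (A₂ k) < 0) :
    Tendsto (fun y => volume {x : unitInterval | (x, y) ∉ basin (skewProduct g₁ g₂) (lineAt k)})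
      (𝓝 k) (𝓝 0) := by
  set l₁ := fun y => Real.log (A₁ y) with hl₁
  set l₂ := fun y => Real.log (A₂ y) with hl₂
  have hcl₁ : ContinuousAt l₁ k := hc₁.log (hA₁ k).ne'
  have hcl₂ : ContinuousAt l₂ k := hc₂.log (hA₂ k).ne'
  set K : ℝ := |l₁ k| + |l₂ k| + 1 with hK
  have hK₁ : |l₁ k| < K := by linarith [abs_nonneg (l₂ k)]
  have hK₂ : |l₂ k| < K := by linarith [abs_nonneg (l₁ k)]
  obtain ⟨s, ρ, hs, hρ0, hρ1, hexp⟩ := exists_exp_avg_le (K := K) (c := -(l₁ k + l₂ k) / 2)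
    (by positivity) (by change l₁ k + l₂ k < 0 at hneg; linarith)
  have hev : ∀ᶠ y in 𝓝 k, |l₁ y| < K ∧ |l₂ y| < K ∧ l₁ y + l₂ y < (l₁ k + l₂ k) / 2 :=
    (hcl₁.abs.eventually_lt_const hK₁).and ((hcl₂.abs.eventually_lt_const hK₂).and
      ((hcl₁.add hcl₂).eventually_lt_const
        (by change l₁ k + l₂ k < _; change l₁ k + l₂ k < 0 at hneg; linarith)))
  obtain ⟨δ, hδ, hball⟩ := Metric.nhds_basis_closedBall.eventually_iff.mp hev
  -- Scaling by `δ` makes `W ≤ 1` the ball on which the estimates hold.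
  set W : unitInterval → ENNReal := fun y => ENNReal.ofReal ((dist y k / δ) ^ s) with hW
  have hWc : Continuous W := by
    refine ENNReal.continuous_ofReal.comp (Continuous.rpow_const ?_ fun _ => Or.inr hs.le)
    exact (continuous_id.dist continuous_const).div_const _
  have hle : ∀ y, W y ≤ 1 → 2⁻¹ * (W (g₁ y) + W (g₂ y)) ≤ ENNReal.ofReal ρ * W y := by
    intro y hy
    have hq : 0 ≤ dist y k / δ := by positivity
    have hyδ : dist y k ≤ δ := by
      rw [hW, ENNReal.ofReal_le_one] at hy
      by_contra! hlt
      exact absurd hy (not_le.mpr (Real.one_lt_rpow ((one_lt_div hδ).mpr hlt) hs))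
    obtain ⟨e1, e2, e3⟩ := hball (Metric.mem_closedBall.mpr hyδ)
    have h := hexp (l₁ y) (l₂ y) e1.le e2.le (by linarith)
    refine ENNReal.half_ofReal_add_le (by positivity) (by positivity) hρ0 ?_
    rw [h₁, h₂, mul_div_right_comm, mul_div_right_comm, Real.rpow_mul_eq_mul_exp hq (hA₁ y),
      Real.rpow_mul_eq_mul_exp hq (hA₂ y)]
    have := mul_le_mul_of_nonneg_left h (Real.rpow_nonneg hq s)
    calc _ = (dist y k / δ) ^ s * ((Real.exp (s * l₁ y) + Real.exp (s * l₂ y)) / 2) := by ring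
      _ ≤ _ := this.trans_eq (mul_comm _ _)
  have hWk : W k = 0 := by simp [hW, Real.zero_rpow hs.ne']
  have hlim : Tendsto (fun y => (1 - ENNReal.ofReal ρ)⁻¹ * W y) (𝓝 k) (𝓝 0) := by
    have hfin : (1 - ENNReal.ofReal ρ)⁻¹ ≠ ⊤ :=
      ENNReal.inv_ne_top.mpr (tsub_pos_of_lt (by simpa using hρ1)).ne'
    have := ENNReal.Tendsto.const_mul (a := (1 - ENNReal.ofReal ρ)⁻¹) (hWc.tendsto k)
      (Or.inr hfin)
    rwa [hWk, mul_zero] at this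
  refine tendsto_of_tendsto_of_tendsto_of_le_of_le tendsto_const_nhds hlim (fun _ => zero_le)
    fun y => (measure_mono fun x hx => ?_).trans
      (volume_not_tendsto_le hg₁.measurable hg₂.measurable hWc.measurable hle y)
  intro ht
  refine hx (mem_basin_lineAt.mpr (Metric.tendsto_nhds.mpr fun ε hε => ?_))
  have hpos : (0 : ENNReal) < ENNReal.ofReal ((ε / δ) ^ s) :=
    ENNReal.ofReal_pos.mpr (by positivity)
  filter_upwards [ht.eventually_lt_const hpos] with n hn
  by_contra! hge
  refine absurd hn (not_lt.mpr (ENNReal.ofReal_le_ofReal ?_))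
  gcongr

/-- On the compact set `0 ≤ D` the penalty `E` has a positive minimum, so a large multiple beats the
maximum of `D`; elsewhere `D` is already negative. Compactness then makes the bound uniform. -/
lemma exists_forall_sub_mul_le {D E : unitInterval → ℝ} (hD : Continuous D) (hE : Continuous E)
    (hE0 : ∀ y, 0 ≤ E y) (h : ∀ y, E y = 0 → D y < 0) :
    ∃ M c : ℝ, 0 ≤ M ∧ 0 < c ∧ ∀ y, D y - M * E y ≤ -c := by
  obtain ⟨M, hM0, hM⟩ : ∃ M : ℝ, 0 ≤ M ∧ ∀ y, D y - M * E y < 0 := by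
    have hcl : IsCompact {y | 0 ≤ D y} := (isClosed_le continuous_const hD).isCompact
    rcases {y | 0 ≤ D y}.eq_empty_or_nonempty with he | hne
    · refine ⟨0, le_rfl, fun y => ?_⟩
      have : y ∉ {y | 0 ≤ D y} := by rw [he]; exact notMem_empty y
      have := not_le.mp (show ¬ 0 ≤ D y from this)
      linarith
    · obtain ⟨a, ha, hmin⟩ := hcl.exists_isMinOn hne hE.continuousOn
      obtain ⟨b, hb, hmax⟩ := hcl.exists_isMaxOn hne hD.continuousOn
      have hEa : 0 < E a := lt_of_le_of_ne (hE0 a) fun h0 =>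
        absurd (h a h0.symm) (not_lt.mpr ha)
      have hDb : 0 ≤ D b := hb
      refine ⟨(D b + 1) / E a, by positivity, fun y => ?_⟩
      by_cases hy : 0 ≤ D y
      · have h1 : E a ≤ E y := hmin hy
        have h2 : D y ≤ D b := hmax hy
        have h3 : (D b + 1) / E a * E a ≤ (D b + 1) / E a * E y := by gcongr
        rw [div_mul_cancel₀ _ hEa.ne'] at h3
        linarith
      · have := hE0 y
        have : 0 ≤ (D b + 1) / E a * E y := by positivity
        linarith [not_le.mp hy]
  obtain ⟨m, -, hm⟩ := isCompact_univ.exists_isMaxOn (univ_nonempty (α := unitInterval))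
    (f := fun y => D y - M * E y) (by fun_prop)
  exact ⟨M, -(D m - M * E m), hM0, by linarith [hM m], fun y => by
    rw [neg_neg]; exact hm (mem_univ y)⟩

lemma exists_forall_abs_le {D : unitInterval → ℝ} (hD : Continuous D) :
    ∃ K, ∀ y, |D y| ≤ K := by
  obtain ⟨K, hK⟩ := isCompact_univ.exists_bound_of_continuousOn (f := D) hD.continuousOn
  exact ⟨K, fun y => hK y (mem_univ y)⟩

/-- With `d = dist y k`, the Lyapunov function is a small power of `d / (1 - d) * exp (M d)`. The
quotient handles both ends, where `hends` makes its mean logarithmic change negative; in between,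
the exponential turns the drift of `d` into a decrease, dominant for large `M`. -/
lemma ae_mem_basin_of_drift (hg₁ : Continuous g₁) (hg₂ : Continuous g₂)
    (hcA₁ : Continuous A₁) (hcA₂ : Continuous A₂) (hcB₁ : Continuous B₁) (hcB₂ : Continuous B₂)
    (hA₁ : ∀ y, 0 < A₁ y) (hA₂ : ∀ y, 0 < A₂ y) (hB₁ : ∀ y, 0 < B₁ y) (hB₂ : ∀ y, 0 < B₂ y)
    (h₁ : ∀ y, dist (g₁ y) k = dist y k * A₁ y) (h₂ : ∀ y, dist (g₂ y) k = dist y k * A₂ y)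
    (h₁' : ∀ y, 1 - dist (g₁ y) k = (1 - dist y k) * B₁ y)
    (h₂' : ∀ y, 1 - dist (g₂ y) k = (1 - dist y k) * B₂ y)
    (hle1 : ∀ y, dist y k ≤ 1)
    {κ : ℝ} (hκ : 0 < κ) (hdrift : ∀ y, dist (g₁ y) k + dist (g₂ y) k =
      2 * dist y k - κ * (dist y k * (1 - dist y k)))
    (hends : ∀ y, dist y k * (1 - dist y k) = 0 →
      Real.log (A₁ y) + Real.log (A₂ y) < Real.log (B₁ y) + Real.log (B₂ y))
    {y : unitInterval} (hy : dist y k < 1) :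
    ∀ᵐ x : unitInterval, (x, y) ∈ basin (skewProduct g₁ g₂) (lineAt k) := by
  have hd : Continuous fun y : unitInterval => dist y k := continuous_id.dist continuous_const
  have hlA₁ : Continuous fun y => Real.log (A₁ y) := hcA₁.log fun y => (hA₁ y).ne'
  have hlA₂ : Continuous fun y => Real.log (A₂ y) := hcA₂.log fun y => (hA₂ y).ne'
  have hlB₁ : Continuous fun y => Real.log (B₁ y) := hcB₁.log fun y => (hB₁ y).ne'
  have hlB₂ : Continuous fun y => Real.log (B₂ y) := hcB₂.log fun y => (hB₂ y).ne'
  obtain ⟨M, c, hM, hc, hMc⟩ := exists_forall_sub_mul_le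
    (D := fun y => (Real.log (A₁ y) - Real.log (B₁ y)) + (Real.log (A₂ y) - Real.log (B₂ y)))
    (E := fun y => κ * (dist y k * (1 - dist y k))) (by fun_prop) (by fun_prop)
    (fun y => mul_nonneg hκ.le (mul_nonneg dist_nonneg (sub_nonneg.mpr (hle1 y))))
    (fun y hy0 => by
      have := hends y ((mul_eq_zero.mp hy0).resolve_left hκ.ne')
      linarith)
  -- `l₁` and `l₂` are the logarithmic increments of `q` under the two fiber maps.
  set l₁ : unitInterval → ℝ := fun y =>
    Real.log (A₁ y) - Real.log (B₁ y) + M * (dist (g₁ y) k - dist y k) with hl₁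
  set l₂ : unitInterval → ℝ := fun y =>
    Real.log (A₂ y) - Real.log (B₂ y) + M * (dist (g₂ y) k - dist y k) with hl₂
  have hl₁c : Continuous l₁ := by
    have : Continuous fun y => dist (g₁ y) k := hd.comp hg₁
    fun_prop
  have hl₂c : Continuous l₂ := by
    have : Continuous fun y => dist (g₂ y) k := hd.comp hg₂
    fun_prop
  have hsum : ∀ y, l₁ y + l₂ y ≤ -c := by
    intro y
    refine le_trans (le_of_eq ?_) (hMc y)
    simp only [hl₁, hl₂]
    linear_combination M * hdrift y
  obtain ⟨K₁, hK₁⟩ := exists_forall_abs_le hl₁c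
  obtain ⟨K₂, hK₂⟩ := exists_forall_abs_le hl₂c
  have hK₁0 := (abs_nonneg _).trans (hK₁ k)
  have hK₂0 := (abs_nonneg _).trans (hK₂ k)
  obtain ⟨s, ρ, hs, hρ0, hρ1, hexp⟩ := exists_exp_avg_le (K := K₁ + K₂ + 1) (c := c)
    (by positivity) hc
  set q : unitInterval → ℝ := fun y => dist y k / (1 - dist y k) * Real.exp (M * dist y k) with hq
  have hq0 : ∀ y, 0 ≤ q y := fun y => by
    have := sub_nonneg.mpr (hle1 y)
    positivity
  have hq₁ : ∀ y, dist y k < 1 → q (g₁ y) = q y * Real.exp (l₁ y) := by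
    intro y hy
    have : 1 - dist y k ≠ 0 := (sub_pos.mpr hy).ne'
    simp only [hq, hl₁]
    rw [h₁', mul_sub, Real.exp_add, Real.exp_sub, Real.exp_sub, Real.exp_log (hA₁ y),
      Real.exp_log (hB₁ y), h₁]
    have := (hB₁ y).ne'
    field_simp
  have hq₂ : ∀ y, dist y k < 1 → q (g₂ y) = q y * Real.exp (l₂ y) := by
    intro y hy
    have : 1 - dist y k ≠ 0 := (sub_pos.mpr hy).ne'
    simp only [hq, hl₂]
    rw [h₂', mul_sub, Real.exp_add, Real.exp_sub, Real.exp_sub, Real.exp_log (hA₂ y),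
      Real.exp_log (hB₂ y), h₂]
    have := (hB₂ y).ne'
    field_simp
  have hlt₁ : ∀ y, dist y k < 1 → dist (g₁ y) k < 1 := fun y hy => by
    have := mul_pos (sub_pos.mpr hy) (hB₁ y)
    rw [← h₁'] at this
    linarith
  have hlt₂ : ∀ y, dist y k < 1 → dist (g₂ y) k < 1 := fun y hy => by
    have := mul_pos (sub_pos.mpr hy) (hB₂ y)
    rw [← h₂'] at this
    linarith
  classical
  set W : unitInterval → ENNReal := fun y =>
    if dist y k < 1 then ENNReal.ofReal (q y ^ s) else ⊤ with hW
  have hqm : Measurable q := by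
    have := hd.measurable
    fun_prop
  have hWm : Measurable W :=
    Measurable.ite (measurableSet_lt hd.measurable measurable_const)
      (ENNReal.measurable_ofReal.comp (hqm.pow_const s)) measurable_const
  -- The maximum with `1/2` keeps the factor nonzero, so that the right side is `⊤` on the opposite
  -- segment, where `W = ⊤`.
  have hle : ∀ y, 2⁻¹ * (W (g₁ y) + W (g₂ y)) ≤ ENNReal.ofReal (max ρ (1 / 2)) * W y := by
    intro y
    by_cases hy : dist y k < 1
    · simp only [hW, if_pos hy, if_pos (hlt₁ y hy), if_pos (hlt₂ y hy)]
      refine ENNReal.half_ofReal_add_le (Real.rpow_nonneg (hq0 _) _) (Real.rpow_nonneg (hq0 _) _)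
        (hρ0.trans (le_max_left _ _)) ?_
      rw [hq₁ y hy, hq₂ y hy, Real.rpow_mul_eq_mul_exp (hq0 y) (Real.exp_pos _),
        Real.rpow_mul_eq_mul_exp (hq0 y) (Real.exp_pos _), Real.log_exp, Real.log_exp]
      have h := (hexp (l₁ y) (l₂ y) (by linarith [hK₁ y]) (by linarith [hK₂ y]) (hsum y)).trans
        (le_max_left ρ (1 / 2))
      have := mul_le_mul_of_nonneg_left h (Real.rpow_nonneg (hq0 y) s)
      linarith
    · simp only [hW, if_neg hy]
      rw [ENNReal.mul_top (ENNReal.ofReal_pos.mpr (by positivity)).ne']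
      exact le_top
  have hρ' : ENNReal.ofReal (max ρ (1 / 2)) < 1 := by
    rw [ENNReal.ofReal_lt_one]
    exact max_lt hρ1 (by norm_num)
  filter_upwards [ae_tendsto_zero_of_lyapunov hg₁.measurable hg₂.measurable hWm hρ' hle (y := y)
    (by simp [hW, hy])] with x hx
  refine mem_basin_lineAt.mpr (Metric.tendsto_nhds.mpr fun ε hε => ?_)
  have hpos : (0 : ENNReal) < ENNReal.ofReal (ε ^ s) := ENNReal.ofReal_pos.mpr (by positivity)
  filter_upwards [hx.eventually_lt_const hpos] with n hn
  by_contra! hge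
  refine absurd hn (not_lt.mpr ?_)
  set w := ((skewProduct g₁ g₂)^[n] (x, y)).2
  simp only [hW]
  split_ifs with hw
  · refine ENNReal.ofReal_le_ofReal (Real.rpow_le_rpow hε.le ?_ hs.le)
    have h1 : 0 < 1 - dist w k := sub_pos.mpr hw
    have h2 : dist w k ≤ dist w k / (1 - dist w k) := by
      rw [le_div_iff₀ h1]
      nlinarith [dist_nonneg (x := w) (y := k)]
    have h3 : 1 ≤ Real.exp (M * dist w k) := Real.one_le_exp (by positivity)
    calc ε ≤ dist w k / (1 - dist w k) := hge.trans h2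
      _ ≤ _ := le_mul_of_one_le_right (by positivity) h3
  · exact le_top

lemma volume_ball_inter_basin_pos (hg₁ : Continuous g₁) (hg₂ : Continuous g₂)
    (hB₁ : ∀ y, 0 < B₁ y) (hB₂ : ∀ y, 0 < B₂ y)
    (h₁' : ∀ y, 1 - dist (g₁ y) k = (1 - dist y k) * B₁ y)
    (h₂' : ∀ y, 1 - dist (g₂ y) k = (1 - dist y k) * B₂ y)
    (hae : ∀ᵐ y : unitInterval, dist y k < 1)
    {κ : ℝ} (hκ : 0 < κ) (hdrift : ∀ y, dist (g₁ y) k + dist (g₂ y) k =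
      2 * dist y k - κ * (dist y k * (1 - dist y k)))
    (hlim : Tendsto (fun y => volume {x : unitInterval |
      (x, y) ∉ basin (skewProduct g₁ g₂) (lineAt k)}) (𝓝 k) (𝓝 0))
    (z : Square) {ε : ℝ} (hε : 0 < ε) :
    0 < volume (Metric.ball z ε ∩ basin (skewProduct g₁ g₂) (lineAt k)) := by
  set F := skewProduct g₁ g₂ with hF
  set B := basin F (lineAt k) with hB
  have hBm : MeasurableSet B :=
    measurableSet_basin_lineAt (measurable_skewProduct hg₁.measurable hg₂.measurable) k
  have hBF : ∀ z, F z ∈ B ↔ z ∈ B := fun z => map_mem_basin_lineAt_iff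
  -- transport of positive slices along one step
  have hstep : ∀ (U V : Set unitInterval) (y : unitInterval), MeasurableSet V →
      (∀ x : unitInterval, (x : ℝ) ≤ 1 / 2 → baseMap x ∈ V → x ∈ U) →
      0 < volume {x : unitInterval | x ∈ V ∧ (x, g₁ y) ∈ B} →
      0 < volume {x : unitInterval | x ∈ U ∧ (x, y) ∈ B} := by
    intro U V y hV hUV hpos
    have hm : MeasurableSet {x : unitInterval | x ∈ V ∧ (x, g₁ y) ∈ B} :=
      hV.inter (measurable_prodMk_right hBm)
    have hl := DFunLike.congr_fun map_baseMap_restrict_le {x : unitInterval | x ∈ V ∧ (x, g₁ y) ∈ B}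
    rw [Measure.map_apply measurable_baseMap hm, Measure.smul_apply, smul_eq_mul,
      Measure.restrict_apply (measurable_baseMap hm)] at hl
    refine lt_of_lt_of_le (ENNReal.mul_pos (a := 2⁻¹) (by simp) hpos.ne') (hl.symm.trans_le
      (measure_mono fun x hx => ⟨hUV x hx.2 hx.1.1, ?_⟩))
    rw [← hBF, hF, skewProduct_of_le hx.2]
    exact hx.1.2
  have hstep' : ∀ (U V : Set unitInterval) (y : unitInterval), MeasurableSet V →
      (∀ x : unitInterval, 1 / 2 < (x : ℝ) → baseMap x ∈ V → x ∈ U) →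
      0 < volume {x : unitInterval | x ∈ V ∧ (x, g₂ y) ∈ B} →
      0 < volume {x : unitInterval | x ∈ U ∧ (x, y) ∈ B} := by
    intro U V y hV hUV hpos
    have hm : MeasurableSet {x : unitInterval | x ∈ V ∧ (x, g₂ y) ∈ B} :=
      hV.inter (measurable_prodMk_right hBm)
    have hl := DFunLike.congr_fun map_baseMap_restrict_gt {x : unitInterval | x ∈ V ∧ (x, g₂ y) ∈ B}
    rw [Measure.map_apply measurable_baseMap hm, Measure.smul_apply, smul_eq_mul,
      Measure.restrict_apply (measurable_baseMap hm)] at hl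
    refine lt_of_lt_of_le (ENNReal.mul_pos (a := 2⁻¹) (by simp) hpos.ne') (hl.symm.trans_le
      (measure_mono fun x hx => ⟨hUV x (not_le.mp hx.2) hx.1.1, ?_⟩))
    rw [← hBF, hF, skewProduct_of_lt hx.2]
    exact hx.1.2
  have hlt₁ : ∀ y, dist y k < 1 → dist (g₁ y) k < 1 := fun y hy => by
    have := mul_pos (sub_pos.mpr hy) (hB₁ y)
    rw [← h₁'] at this
    linarith
  have hlt₂ : ∀ y, dist y k < 1 → dist (g₂ y) k < 1 := fun y hy => by
    have := mul_pos (sub_pos.mpr hy) (hB₂ y)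
    rw [← h₂'] at this
    linarith
  -- every slice off the opposite segment meets the basin
  have hslice : ∀ y, dist y k < 1 → 0 < volume {x : unitInterval | x ∈ univ ∧ (x, y) ∈ B} := by
    have h1 : (0 : ENNReal) < 1 := one_pos
    obtain ⟨δ, hδ, hnear⟩ := Metric.eventually_nhds_iff_ball.mp (hlim.eventually_lt_const h1)
    have hnear' : ∀ y, dist y k < δ → 0 < volume {x : unitInterval | x ∈ univ ∧ (x, y) ∈ B} := by
      intro y hy
      rw [pos_iff_ne_zero]
      intro h0
      have hz := prob_compl_eq_one_iff (μ := (volume : Measure unitInterval))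
        (s := {x : unitInterval | x ∈ univ ∧ (x, y) ∈ B})
        (MeasurableSet.univ.inter (measurable_prodMk_right hBm)) |>.mpr h0
      have hy' := hnear y (Metric.mem_ball.mpr hy)
      refine absurd hz (ne_of_lt (lt_of_le_of_lt (measure_mono ?_) hy'))
      intro x hx hxB
      exact hx ⟨mem_univ x, hxB⟩
    intro y hy
    rw [pos_iff_ne_zero]
    intro h0
    -- A null slice forces null slices at both image heights. One image is closer to `k` by at least
    -- `κ/2 * δ * (1 - dist y k)`, since heights within `δ` have positive slices and are excluded.
    -- Iteration would make a distance negative.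
    have hdesc : ∀ n : ℕ, ∃ w : unitInterval,
        dist w k ≤ dist y k - n * (κ / 2 * δ * (1 - dist y k)) ∧
          volume {x : unitInterval | x ∈ univ ∧ (x, w) ∈ B} = 0 := by
      intro n
      induction n with
      | zero => exact ⟨y, by simp, h0⟩
      | succ n ih =>
        obtain ⟨w, hw, hw0⟩ := ih
        have hδw : δ ≤ dist w k := by
          by_contra! hlt
          exact (hnear' w hlt).ne' hw0
        have hwy : dist w k ≤ dist y k := by
          have : 0 ≤ n * (κ / 2 * δ * (1 - dist y k)) := by
            have := sub_pos.mpr hy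
            positivity
          linarith
        have hn₁ : volume {x : unitInterval | x ∈ univ ∧ (x, g₁ w) ∈ B} = 0 := by
          by_contra hne
          exact (hstep univ univ w .univ (fun _ _ _ => mem_univ _) (pos_iff_ne_zero.mpr hne)).ne'
            hw0
        have hn₂ : volume {x : unitInterval | x ∈ univ ∧ (x, g₂ w) ∈ B} = 0 := by
          by_contra hne
          exact (hstep' univ univ w .univ (fun _ _ _ => mem_univ _) (pos_iff_ne_zero.mpr hne)).ne'
            hw0
        have hprod : δ * (1 - dist y k) ≤ dist w k * (1 - dist w k) :=
          mul_le_mul hδw (by linarith) (sub_pos.mpr hy).le dist_nonneg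
        have hprod' := mul_le_mul_of_nonneg_left hprod hκ.le
        have hd := hdrift w
        push_cast
        rcases le_total (dist (g₁ w) k) (dist (g₂ w) k) with hle | hle
        · exact ⟨g₁ w, by linarith, hn₁⟩
        · exact ⟨g₂ w, by linarith, hn₂⟩
    have hpos : 0 < κ / 2 * δ * (1 - dist y k) := by
      have := sub_pos.mpr hy
      positivity
    obtain ⟨n, hn⟩ := exists_nat_gt (1 / (κ / 2 * δ * (1 - dist y k)))
    rw [div_lt_iff₀ hpos] at hn
    obtain ⟨w, hw, -⟩ := hdesc n
    linarith [dist_nonneg (x := w) (y := k)]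
  -- localization in the base
  have hloc : ∀ (n : ℕ) (x₀ : unitInterval) (r : ℝ), 1 < 2 ^ n * r → ∀ y, dist y k < 1 →
      0 < volume {x : unitInterval | x ∈ Metric.ball x₀ r ∧ (x, y) ∈ B} := by
    intro n
    induction n with
    | zero =>
      intro x₀ r hr y hy
      refine (hslice y hy).trans_le (measure_mono fun x hx => ⟨?_, hx.2⟩)
      rw [Metric.mem_ball, Subtype.dist_eq, Real.dist_eq, abs_lt]
      constructor <;> linarith [x.2.1, x.2.2, x₀.2.1, x₀.2.2]
    | succ n ih =>
      intro x₀ r hr y hy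
      -- Each branch doubles distances: the ball of radius `2 * r` about the image pulls back along
      -- the branch of `x₀` into the ball of radius `r`. After `n + 1` doublings the ball is
      -- everything.
      have hr' : 1 < 2 ^ n * (2 * r) := by rw [← mul_assoc, ← pow_succ]; exact hr
      by_cases hx₀ : (x₀ : ℝ) ≤ 1 / 2
      · refine hstep _ _ y Metric.isOpen_ball.measurableSet ?_ (ih (baseMap x₀) (2 * r) hr' _
          (hlt₁ y hy))
        intro x hx hb
        rw [Metric.mem_ball, Subtype.dist_eq, Real.dist_eq, abs_lt] at hb ⊢
        rw [coe_baseMap_of_le hx, coe_baseMap_of_le hx₀] at hb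
        constructor <;> linarith
      · refine hstep' _ _ y Metric.isOpen_ball.measurableSet ?_ (ih (baseMap x₀) (2 * r) hr' _
          (hlt₂ y hy))
        intro x hx hb
        rw [Metric.mem_ball, Subtype.dist_eq, Real.dist_eq, abs_lt] at hb ⊢
        rw [coe_baseMap_of_lt hx, coe_baseMap_of_lt (not_le.mp hx₀)] at hb
        constructor <;> linarith
  obtain ⟨n, hn⟩ := pow_unbounded_of_one_lt (1 / ε) (one_lt_two (α := ℝ))
  rw [div_lt_iff₀ hε] at hn
  rw [pos_iff_ne_zero, Measure.volume_eq_prod,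
    Measure.prod_apply_symm (Metric.isOpen_ball.measurableSet.inter hBm)]
  intro h0
  rw [lintegral_eq_zero_iff
    (measurable_measure_prodMk_right (Metric.isOpen_ball.measurableSet.inter hBm))] at h0
  refine (Metric.isOpen_ball.measure_pos volume
    (Metric.nonempty_ball.mpr hε : (Metric.ball z.2 ε).Nonempty)).ne' ?_
  rw [measure_eq_zero_iff_ae_notMem]
  filter_upwards [h0, hae] with y hy0 hy hyb
  refine (hloc n z.1 ε hn y hy).ne' (measure_mono_null ?_ hy0)
  rintro x ⟨hx, hxB⟩
  refine ⟨?_, hxB⟩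
  rw [Metric.mem_ball, Prod.dist_eq]
  exact max_lt hx hyb

end Fiber

/-! ### The cubic fiber maps -/

lemma cubicSkew_eq_skewProduct (p : Param) :
    cubicSkew p = skewProduct (fiberOne p.1) (fiberTwo p.2) := rfl

lemma continuous_fiberOne (β : Ioo (0 : ℝ) 1) : Continuous (fiberOne β) :=
  Continuous.subtype_mk (by fun_prop) _

lemma continuous_fiberTwo (β : Ioo (0 : ℝ) 1) : Continuous (fiberTwo β) :=
  Continuous.subtype_mk (by fun_prop) _

lemma coe_fiberOne (β : Ioo (0 : ℝ) 1) (y : unitInterval) :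
    (fiberOne β y : ℝ) = y + y * (1 - y) * (y - β) := rfl

lemma coe_fiberTwo (β : Ioo (0 : ℝ) 1) (y : unitInterval) :
    (fiberTwo β y : ℝ) = y - y * (1 - y) * (y - β) := rfl

lemma unitInterval_dist_zero (y : unitInterval) : dist y 0 = y := by
  rw [Subtype.dist_eq, Real.dist_eq, Icc.coe_zero, sub_zero, abs_of_nonneg y.2.1]

lemma unitInterval_dist_one (y : unitInterval) : dist y 1 = 1 - y := by
  rw [Subtype.dist_eq, Real.dist_eq, Icc.coe_one, abs_sub_comm,
    abs_of_nonneg (sub_nonneg.mpr y.2.2)]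

/-- The factor by which the first fiber map changes the distance to the end point `j`. -/
noncomputable def ratioOne (β : ℝ) (j : unitInterval) (y : unitInterval) : ℝ :=
  -- This is `1 + (1-y)(y-β)` for `j = 0` and `1 - y(y-β)` for `j = 1`; one formula serves both
  -- ends.
  1 + (1 - 2 * j) * ((1 - j) - (1 - 2 * j) * y) * (y - β)

/-- The factor by which the second fiber map changes the distance to the end point `j`. -/
noncomputable def ratioTwo (β : ℝ) (j : unitInterval) (y : unitInterval) : ℝ :=
  1 - (1 - 2 * j) * ((1 - j) - (1 - 2 * j) * y) * (y - β)

lemma continuous_ratioOne (β : ℝ) (j : unitInterval) : Continuous (ratioOne β j) := by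
  unfold ratioOne; fun_prop

lemma continuous_ratioTwo (β : ℝ) (j : unitInterval) : Continuous (ratioTwo β j) := by
  unfold ratioTwo; fun_prop

section Ends

variable {j k : unitInterval}

lemma ratioOne_pos (hj : j = 0 ∨ j = 1) (β : Ioo (0 : ℝ) 1) (y : unitInterval) :
    0 < ratioOne β j y := by
  obtain ⟨y, hy0, hy1⟩ := y
  obtain ⟨b, hb0, hb1⟩ := β
  rcases hj with rfl | rfl <;> simp only [ratioOne, Icc.coe_zero, Icc.coe_one] <;>
    nlinarith [mul_nonneg hy0 (sub_nonneg.mpr hy1), mul_nonneg hy0 hb0.le,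
      mul_nonneg (sub_nonneg.mpr hy1) (sub_nonneg.mpr hb1.le),
      mul_nonneg hy0 (sub_nonneg.mpr hb1.le), mul_nonneg (sub_nonneg.mpr hy1) hb0.le]

lemma ratioTwo_pos (hj : j = 0 ∨ j = 1) (β : Ioo (0 : ℝ) 1) (y : unitInterval) :
    0 < ratioTwo β j y := by
  obtain ⟨y, hy0, hy1⟩ := y
  obtain ⟨b, hb0, hb1⟩ := β
  rcases hj with rfl | rfl <;> simp only [ratioTwo, Icc.coe_zero, Icc.coe_one] <;>
    nlinarith [mul_nonneg hy0 (sub_nonneg.mpr hy1), mul_nonneg hy0 hb0.le,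
      mul_nonneg (sub_nonneg.mpr hy1) (sub_nonneg.mpr hb1.le), sq_nonneg y, sq_nonneg (y - 1),
      mul_nonneg hy0 (sub_nonneg.mpr hb1.le), mul_nonneg (sub_nonneg.mpr hy1) hb0.le]

lemma dist_fiberOne (hj : j = 0 ∨ j = 1) (β : Ioo (0 : ℝ) 1) (y : unitInterval) :
    dist (fiberOne β y) j = dist y j * ratioOne β j y := by
  rcases hj with rfl | rfl <;>
    simp only [unitInterval_dist_zero, unitInterval_dist_one, coe_fiberOne, ratioOne,
      Icc.coe_zero, Icc.coe_one] <;> ring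

lemma dist_fiberTwo (hj : j = 0 ∨ j = 1) (β : Ioo (0 : ℝ) 1) (y : unitInterval) :
    dist (fiberTwo β y) j = dist y j * ratioTwo β j y := by
  rcases hj with rfl | rfl <;>
    simp only [unitInterval_dist_zero, unitInterval_dist_one, coe_fiberTwo, ratioTwo,
      Icc.coe_zero, Icc.coe_one] <;> ring

lemma fiberOne_end (hj : j = 0 ∨ j = 1) (β : Ioo (0 : ℝ) 1) : fiberOne β j = j :=
  dist_eq_zero.mp (by rw [dist_fiberOne hj, dist_self, zero_mul])

lemma fiberTwo_end (hj : j = 0 ∨ j = 1) (β : Ioo (0 : ℝ) 1) : fiberTwo β j = j :=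
  dist_eq_zero.mp (by rw [dist_fiberTwo hj, dist_self, zero_mul])

lemma hasDerivWithinAt_fiberOne (hj : j = 0 ∨ j = 1) (β : Ioo (0 : ℝ) 1) :
    HasDerivWithinAt (fun v : ℝ => (fiberOne β (projIcc 0 1 zero_le_one v) : ℝ))
      (ratioOne β j j) (Icc 0 1) j := by
  have h : HasDerivAt (fun v : ℝ => v + v * (1 - v) * (v - β)) (ratioOne β j j) j := by
    have := (hasDerivAt_id (j : ℝ)).add
      ((((hasDerivAt_id (j : ℝ)).mul ((hasDerivAt_id (j : ℝ)).const_sub 1))).mul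
        ((hasDerivAt_id (j : ℝ)).sub_const (β : ℝ)))
    refine this.congr_deriv ?_
    rcases hj with rfl | rfl
    · simp [ratioOne]
    · simp [ratioOne]; ring
  refine h.hasDerivWithinAt.congr_of_mem (fun v hv => ?_) j.2
  rw [coe_fiberOne, projIcc_of_mem _ hv]

lemma hasDerivWithinAt_fiberTwo (hj : j = 0 ∨ j = 1) (β : Ioo (0 : ℝ) 1) :
    HasDerivWithinAt (fun v : ℝ => (fiberTwo β (projIcc 0 1 zero_le_one v) : ℝ))
      (ratioTwo β j j) (Icc 0 1) j := by
  have h : HasDerivAt (fun v : ℝ => v - v * (1 - v) * (v - β)) (ratioTwo β j j) j := by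
    have := (hasDerivAt_id (j : ℝ)).sub
      ((((hasDerivAt_id (j : ℝ)).mul ((hasDerivAt_id (j : ℝ)).const_sub 1))).mul
        ((hasDerivAt_id (j : ℝ)).sub_const (β : ℝ)))
    refine this.congr_deriv ?_
    rcases hj with rfl | rfl
    · simp [ratioTwo]
    · simp [ratioTwo]; ring
  refine h.hasDerivWithinAt.congr_of_mem (fun v hv => ?_) j.2
  rw [coe_fiberTwo, projIcc_of_mem _ hv]

/-- The normal Lyapunov exponent of the segment at height `j`. -/
noncomputable def normalExponent (j : unitInterval) (p : Param) : ℝ :=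
  (Real.log (ratioOne p.1 j j) + Real.log (ratioTwo p.2 j j)) / 2

lemma normalExponent_eq_log (hj : j = 0 ∨ j = 1) (p : Param) :
    normalExponent j p = Real.log (ratioOne p.1 j j * ratioTwo p.2 j j) / 2 := by
  rw [normalExponent, Real.log_mul (ratioOne_pos hj _ _).ne' (ratioTwo_pos hj _ _).ne']

lemma normalExponent_neg_iff (hj : j = 0 ∨ j = 1) (p : Param) :
    normalExponent j p < 0 ↔ ratioOne p.1 j j * ratioTwo p.2 j j < 1 := by
  have hpos := mul_pos (ratioOne_pos hj p.1 j) (ratioTwo_pos hj p.2 j)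
  rw [normalExponent_eq_log hj, ← Real.log_neg_iff hpos]
  constructor <;> intro h <;> linarith

lemma normalExponent_pos_iff (hj : j = 0 ∨ j = 1) (p : Param) :
    0 < normalExponent j p ↔ 1 < ratioOne p.1 j j * ratioTwo p.2 j j := by
  have hpos := mul_pos (ratioOne_pos hj p.1 j) (ratioTwo_pos hj p.2 j)
  rw [normalExponent_eq_log hj, ← Real.log_pos_iff hpos.le]
  constructor <;> intro h <;> linarith

lemma continuous_normalExponent (hj : j = 0 ∨ j = 1) : Continuous (normalExponent j) := by
  have h₁ : Continuous fun p : Param => Real.log (ratioOne p.1 j j) :=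
    Continuous.log (by unfold ratioOne; fun_prop) fun p => (ratioOne_pos hj _ _).ne'
  have h₂ : Continuous fun p : Param => Real.log (ratioTwo p.2 j j) :=
    Continuous.log (by unfold ratioTwo; fun_prop) fun p => (ratioTwo_pos hj _ _).ne'
  exact (h₁.add h₂).div_const 2

/-- The coefficient of the mean drift of the fiber maps towards the end point `k`. -/
noncomputable def meanDrift (k : unitInterval) (p : Param) : ℝ :=
  (2 * k - 1) * ((p.2 : ℝ) - p.1)

lemma continuous_meanDrift (k : unitInterval) : Continuous (meanDrift k) := by
  unfold meanDrift; fun_prop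

/-- The cubic terms cancel: the two displacements add up to `y(1-y)(β₂-β₁)`, of constant sign. -/
lemma dist_fiber_add (hk : k = 0 ∨ k = 1) (p : Param) (y : unitInterval) :
    dist (fiberOne p.1 y) k + dist (fiberTwo p.2 y) k =
      2 * dist y k - meanDrift k p * (dist y k * (1 - dist y k)) := by
  rcases hk with rfl | rfl <;>
    simp only [unitInterval_dist_zero, unitInterval_dist_one, coe_fiberOne, coe_fiberTwo, meanDrift,
      Icc.coe_zero, Icc.coe_one] <;> ring

/-! ### Basins of the two segments for the cubic family -/

lemma tendsto_volume_notMem_basin_cubicSkew (hj : j = 0 ∨ j = 1) {p : Param}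
    (hneg : normalExponent j p < 0) :
    Tendsto (fun y => volume {x : unitInterval | (x, y) ∉ basin (cubicSkew p) (lineAt j)})
      (𝓝 j) (𝓝 0) :=
  tendsto_volume_notMem_basin (continuous_fiberOne _) (continuous_fiberTwo _)
    (continuous_ratioOne _ _).continuousAt (continuous_ratioTwo _ _).continuousAt
    (ratioOne_pos hj _) (ratioTwo_pos hj _) (dist_fiberOne hj _) (dist_fiberTwo hj _)
    (by unfold normalExponent at hneg; linarith)

lemma measurable_cubicSkew (p : Param) : Measurable (cubicSkew p) :=
  measurable_skewProduct (continuous_fiberOne _).measurable (continuous_fiberTwo _).measurable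

lemma one_sub_dist_eq (hjk : j = 0 ∧ k = 1 ∨ j = 1 ∧ k = 0) (y : unitInterval) :
    1 - dist y k = dist y j := by
  rcases hjk with ⟨rfl, rfl⟩ | ⟨rfl, rfl⟩
  · rw [unitInterval_dist_zero, unitInterval_dist_one, sub_sub_cancel]
  · rw [unitInterval_dist_zero, unitInterval_dist_one]

/-- The far end is fixed, so its distance to `j` does not change. -/
lemma ratioOne_opposite (hjk : j = 0 ∧ k = 1 ∨ j = 1 ∧ k = 0) (β : ℝ) : ratioOne β j k = 1 := by
  rcases hjk with ⟨rfl, rfl⟩ | ⟨rfl, rfl⟩ <;> simp [ratioOne]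

lemma ratioTwo_opposite (hjk : j = 0 ∧ k = 1 ∨ j = 1 ∧ k = 0) (β : ℝ) : ratioTwo β j k = 1 := by
  rcases hjk with ⟨rfl, rfl⟩ | ⟨rfl, rfl⟩ <;> simp [ratioTwo]

lemma ae_dist_lt_one (hjk : j = 0 ∧ k = 1 ∨ j = 1 ∧ k = 0) :
    ∀ᵐ y : unitInterval, dist y k < 1 := by
  have h : ∀ᵐ y : unitInterval, y ≠ j := compl_mem_ae_iff.mpr (measure_singleton _)
  filter_upwards [h] with y hy
  have := dist_pos.mpr hy
  rw [← one_sub_dist_eq hjk] at this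
  linarith

lemma volume_ball_inter_basin_cubicSkew_pos (hjk : j = 0 ∧ k = 1 ∨ j = 1 ∧ k = 0)
    {p : Param} (hneg : normalExponent k p < 0)
    (hdrift : 0 < meanDrift k p) (z : Square) {ε : ℝ} (hε : 0 < ε) :
    0 < volume (Metric.ball z ε ∩ basin (cubicSkew p) (lineAt k)) := by
  have hj : j = 0 ∨ j = 1 := hjk.imp And.left And.left
  have hk : k = 0 ∨ k = 1 := hjk.symm.imp And.right And.right
  exact volume_ball_inter_basin_pos (continuous_fiberOne _) (continuous_fiberTwo _)
    (ratioOne_pos hj p.1) (ratioTwo_pos hj p.2)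
    (fun y => by rw [one_sub_dist_eq hjk, one_sub_dist_eq hjk, dist_fiberOne hj])
    (fun y => by rw [one_sub_dist_eq hjk, one_sub_dist_eq hjk, dist_fiberTwo hj])
    (ae_dist_lt_one hjk) hdrift (dist_fiber_add hk p)
    (tendsto_volume_notMem_basin_cubicSkew hk hneg) z hε

lemma ae_mem_basin_cubicSkew (hjk : j = 0 ∧ k = 1 ∨ j = 1 ∧ k = 0)
    {p : Param} (hpos : 0 < normalExponent j p)
    (hneg : normalExponent k p < 0) (hdrift : 0 < meanDrift k p) :
    ∀ᵐ z : Square, z ∈ basin (cubicSkew p) (lineAt k) := by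
  have hj : j = 0 ∨ j = 1 := hjk.imp And.left And.left
  have hk : k = 0 ∨ k = 1 := hjk.symm.imp And.right And.right
  have hkj : k = 0 ∧ j = 1 ∨ k = 1 ∧ j = 0 := hjk.symm.imp And.symm And.symm
  have hslice : ∀ y : unitInterval, dist y k < 1 →
      ∀ᵐ x : unitInterval, (x, y) ∈ basin (cubicSkew p) (lineAt k) := fun y hy =>
    ae_mem_basin_of_drift (continuous_fiberOne _) (continuous_fiberTwo _)
      (continuous_ratioOne p.1 k) (continuous_ratioTwo p.2 k)
      (continuous_ratioOne p.1 j) (continuous_ratioTwo p.2 j)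
      (ratioOne_pos hk p.1) (ratioTwo_pos hk p.2) (ratioOne_pos hj p.1) (ratioTwo_pos hj p.2)
      (dist_fiberOne hk _) (dist_fiberTwo hk _)
      (fun y => by rw [one_sub_dist_eq hjk, one_sub_dist_eq hjk, dist_fiberOne hj])
      (fun y => by rw [one_sub_dist_eq hjk, one_sub_dist_eq hjk, dist_fiberTwo hj])
      (fun y => by
        have := one_sub_dist_eq hjk y
        linarith [dist_nonneg (x := y) (y := j)]) hdrift (dist_fiber_add hk p)
      (fun y hy0 => by
        rw [one_sub_dist_eq hjk] at hy0
        unfold normalExponent at hpos hneg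
        -- At height `k` the inequality is the negative exponent of `k`, at height `j` the positive
        -- exponent of `j`; the other factors are `1`.
        rcases mul_eq_zero.mp hy0 with h | h
        · rw [dist_eq_zero.mp h, ratioOne_opposite hjk, ratioTwo_opposite hjk, Real.log_one]
          linarith
        · rw [dist_eq_zero.mp h, ratioOne_opposite hkj, ratioTwo_opposite hkj, Real.log_one]
          linarith) hy
  have hm := measurableSet_basin_lineAt (measurable_cubicSkew p) k
  rw [ae_iff]
  change volume (basin (cubicSkew p) (lineAt k))ᶜ = 0
  rw [Measure.volume_eq_prod, Measure.prod_apply_symm hm.compl,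
    lintegral_eq_zero_iff (measurable_measure_prodMk_right hm.compl)]
  filter_upwards [ae_dist_lt_one hjk] with y hy
  exact hslice y hy

/-- The bifurcation is reduced to signs. Those of `hneg` and `hdrift` persist near `p₀` by
continuity, on both sides of the curve; only the sign at `j` changes. -/
lemma isHystereticBlowout_cubicSkew (hjk : j = 0 ∧ k = 1 ∨ j = 1 ∧ k = 0)
    {p₀ : Param} {Pre Post : Set Param}
    (hPre : p₀ ∈ closure Pre) (hPost : p₀ ∈ closure Post)
    (hpre : ∀ p ∈ Pre, normalExponent j p < 0) (hpost : ∀ p ∈ Post, 0 < normalExponent j p)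
    (hzero : normalExponent j p₀ = 0) (hneg : normalExponent k p₀ < 0)
    (hdrift : 0 < meanDrift k p₀) :
    IsHystereticBlowout cubicSkew j (lineAt j) Pre Post p₀ := by
  have hj : j = 0 ∨ j = 1 := hjk.imp And.left And.left
  have hk : k = 0 ∨ k = 1 := hjk.symm.imp And.right And.right
  have hne : j ≠ k := by rcases hjk with ⟨rfl, rfl⟩ | ⟨rfl, rfl⟩ <;> simp
  have hnear : ∀ S : Set Param, ∀ᶠ p in 𝓝[S] p₀,
      p ∈ S ∧ normalExponent k p < 0 ∧ 0 < meanDrift k p := fun S =>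
    eventually_mem_nhdsWithin.and <| nhdsWithin_le_nhds <|
      ((continuous_normalExponent hk).tendsto p₀ |>.eventually_lt_const hneg).and
        ((continuous_meanDrift k).tendsto p₀ |>.eventually_const_lt hdrift)
  have hm₁ : ∀ p : Param, Measurable (fiberOne p.1) := fun p => (continuous_fiberOne _).measurable
  have hm₂ : ∀ p : Param, Measurable (fiberTwo p.2) := fun p => (continuous_fiberTwo _).measurable
  -- One half of the square, the same for all parameters: orbits converging to the segment at `k`
  -- leave it for good.
  set U : Set Square := {z | 1 / 2 < dist z.2 k} with hU
  have hUo : IsOpen U := isOpen_lt continuous_const (continuous_snd.dist continuous_const)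
  have hUn : U ∈ 𝓝ˢ (lineAt j) := by
    refine hUo.mem_nhdsSet.mpr ?_
    rintro ⟨x, y⟩ (rfl : y = j)
    have := one_sub_dist_eq hjk y
    rw [dist_self] at this
    change 1 / 2 < dist y k
    linarith
  have hleave : ∀ (p : Param) (z : Square), z ∈ basin (cubicSkew p) (lineAt k) →
      ∀ᶠ n : ℕ in atTop, (cubicSkew p)^[n] z ∉ U := by
    intro p z hz
    filter_upwards [Metric.tendsto_nhds.mp (mem_basin_lineAt.mp hz) (1 / 2) (by norm_num)] with n hn
    exact not_lt.mpr hn.le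
  have hdisj : ∀ (p : Param) (z : Square), z ∈ basin (cubicSkew p) (lineAt k) →
      z ∉ basin (cubicSkew p) (lineAt j) := fun p z hzk hzj =>
    hne (tendsto_nhds_unique (mem_basin_lineAt.mp hzj) (mem_basin_lineAt.mp hzk))
  refine ⟨⟨hPre, hPost⟩, ?_, fun p => isAsymptoticallyStableIn_lineAt (fiberOne_end hj _)
    (fiberTwo_end hj _), ⟨lineMeasure j, normalExponent j, ?_, ?_, continuous_normalExponent hj,
      hzero, ?_, ?_⟩, ?_, ?_, U, hUn, ?_⟩
  · rintro p q ⟨x, y⟩ (rfl : y = j)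
    rw [cubicSkew_eq_skewProduct, cubicSkew_eq_skewProduct,
      skewProduct_line (fiberOne_end hj _) (fiberTwo_end hj _),
      skewProduct_line (fiberOne_end hj _) (fiberTwo_end hj _)]
  · exact fun p => isSRBMeasure_lineMeasure (hm₁ p) (hm₂ p) (fiberOne_end hj _) (fiberTwo_end hj _)
  · exact fun p => ae_hasNormalExponentAt (fiberOne_end hj _) (fiberTwo_end hj _)
      (hasDerivWithinAt_fiberOne hj _) (hasDerivWithinAt_fiberTwo hj _) (ratioOne_pos hj _ _)
      (ratioTwo_pos hj _ _)
  · exact eventually_mem_nhdsWithin.mono hpre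
  · exact eventually_mem_nhdsWithin.mono hpost
  · filter_upwards [hnear Pre] with p ⟨hp, hpk, hpd⟩
    have hess : IsEssentialAttractor (cubicSkew p) (lineAt j) :=
      isEssentialAttractor_lineAt (hm₁ p) (hm₂ p) (fiberOne_end hj _) (fiberTwo_end hj _)
        (tendsto_volume_notMem_basin_cubicSkew hj (hpre p hp))
    have hch : IsChaoticAttractor (cubicSkew p) (lineAt j) :=
      isChaoticAttractor_lineAt (hm₁ p) (hm₂ p) (fiberOne_end hj _) (fiberTwo_end hj _)
        (hasDerivWithinAt_fiberOne hj _) (hasDerivWithinAt_fiberTwo hj _) hess.volume_basin_pos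
    refine ⟨hch, hess, ⟨hch.1, U, hUn, fun z _ ε hε => ?_⟩, fun z ε hε => ?_⟩
    · refine (volume_ball_inter_basin_cubicSkew_pos hjk hpk hpd z hε).trans_le
        (measure_mono (inter_subset_inter_right _ fun w hw hwU => ?_))
      obtain ⟨n, hn⟩ := (hleave p w hw).exists
      exact hn (mem_iInter.mp hwU n)
    · exact (volume_ball_inter_basin_cubicSkew_pos hjk hpk hpd z hε).trans_le
        (measure_mono (inter_subset_inter_right _ (hdisj p)))
  · filter_upwards [hnear Post] with p ⟨hp, hpk, hpd⟩
    have hst : IsAsymptoticallyStableIn (cubicSkew p) (lineAt j) (lineAt j) :=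
      isAsymptoticallyStableIn_lineAt (fiberOne_end hj _) (fiberTwo_end hj _)
    refine ⟨hst.1, isTransitiveSet_lineAt (fiberOne_end hj _) (fiberTwo_end hj _), ?_, ?_⟩
    · obtain ⟨V, hV, hVb⟩ := hst.2.2.2.2
      exact ⟨V, hV, (0, j), hVb ⟨subset_of_mem_nhdsSet hV rfl, rfl⟩, subset_of_mem_nhdsSet hV rfl⟩
    · rw [measure_eq_zero_iff_ae_notMem]
      filter_upwards [ae_mem_basin_cubicSkew hjk (hpost p hp) hpk hpd] with z hz
      exact hdisj p z hz
  · filter_upwards [hnear Post] with p ⟨hp, hpk, hpd⟩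
    filter_upwards [ae_mem_basin_cubicSkew hjk (hpost p hp) hpk hpd] with z hz _
    exact hleave p z hz

end Ends

/-! ### The two bifurcation curves -/

lemma mem_closure_of_forall_lt {p : Param} {S : Set Param}
    (h : ∀ b : Ioo (0 : ℝ) 1, b < p.2 → (p.1, b) ∈ S) : p ∈ closure S := by
  have hb : p.2 ∈ closure (Iio p.2) := by
    rw [closure_Iio]; exact self_mem_Iic
  exact map_mem_closure (f := fun b => ((p.1, b) : Param)) (by fun_prop) hb h

lemma mem_closure_of_forall_gt {p : Param} {S : Set Param}
    (h : ∀ b : Ioo (0 : ℝ) 1, p.2 < b → (p.1, b) ∈ S) : p ∈ closure S := by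
  have hb : p.2 ∈ closure (Ioi p.2) := by
    rw [closure_Ioi]; exact self_mem_Ici
  exact map_mem_closure (f := fun b => ((p.1, b) : Param)) (by fun_prop) hb h

theorem mainTheorem11 :
    (∀ p : Param, (p.1 : ℝ) < 1 / 2 → (p.2 : ℝ) = 1 / (1 - (p.1 : ℝ)) - 1 →
      IsHystereticBlowout cubicSkew 0 (lineAt 0)
        {q : Param | (q.2 : ℝ) < 1 / (1 - (q.1 : ℝ)) - 1}
        {q : Param | 1 / (1 - (q.1 : ℝ)) - 1 < (q.2 : ℝ)} p) ∧
    (∀ p : Param, 1 / 2 < (p.1 : ℝ) → (p.2 : ℝ) = 2 - 1 / (p.1 : ℝ) →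
      IsHystereticBlowout cubicSkew 1 (lineAt 1)
        {q : Param | 2 - 1 / (q.1 : ℝ) < (q.2 : ℝ)}
        {q : Param | (q.2 : ℝ) < 2 - 1 / (q.1 : ℝ)} p) := by
  have e0 : ∀ q : Param, ratioOne q.1 0 0 * ratioTwo q.2 0 0 = (1 - q.1) * (1 + q.2) := by
    intro q; simp only [ratioOne, ratioTwo, Icc.coe_zero]; ring
  have e1 : ∀ q : Param, ratioOne q.1 1 1 * ratioTwo q.2 1 1 = q.1 * (2 - q.2) := by
    intro q; simp only [ratioOne, ratioTwo, Icc.coe_one]; ring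
  refine ⟨fun p hp heq => ?_, fun p hp heq => ?_⟩
  · have h1 : ∀ q : Param, 0 < 1 - (q.1 : ℝ) := fun q => sub_pos.mpr q.1.2.2
    have hcurve : (1 - (p.1 : ℝ)) * (1 + p.2) = 1 := by
      have := (h1 p).ne'
      rw [heq]; field_simp; ring
    refine isHystereticBlowout_cubicSkew (k := 1) (Or.inl ⟨rfl, rfl⟩)
      (mem_closure_of_forall_lt fun b hb => ?_) (mem_closure_of_forall_gt fun b hb => ?_)
      (fun q hq => ?_) (fun q hq => ?_) ?_ ?_ ?_
    · exact lt_of_lt_of_eq (Subtype.coe_lt_coe.mpr hb) heq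
    · exact lt_of_eq_of_lt heq.symm (Subtype.coe_lt_coe.mpr hb)
    · rw [normalExponent_neg_iff (Or.inl rfl), e0]
      have hq' : (q.2 : ℝ) + 1 < 1 / (1 - (q.1 : ℝ)) := lt_sub_iff_add_lt.mp hq
      rw [lt_div_iff₀ (h1 q)] at hq'
      linarith
    · rw [normalExponent_pos_iff (Or.inl rfl), e0]
      have hq' : 1 / (1 - (q.1 : ℝ)) < q.2 + 1 := sub_lt_iff_lt_add.mp hq
      rw [div_lt_iff₀ (h1 q)] at hq'
      linarith
    · rw [normalExponent_eq_log (Or.inl rfl), e0, hcurve, Real.log_one, zero_div]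
    · rw [normalExponent_neg_iff (Or.inr rfl), e1]
      nlinarith [p.1.2.1, p.1.2.2, p.2.2.1, p.2.2.2]
    -- On this curve `β₂ - β₁ = β₁β₂`.
    · have : 0 < (p.1 : ℝ) * p.2 := mul_pos p.1.2.1 p.2.2.1
      rw [meanDrift, Icc.coe_one]
      nlinarith
  · have h0 : ∀ q : Param, 0 < (q.1 : ℝ) := fun q => q.1.2.1
    have hcurve : (p.1 : ℝ) * (2 - p.2) = 1 := by
      have := (h0 p).ne'
      rw [heq]; field_simp; ring
    refine isHystereticBlowout_cubicSkew (k := 0) (Or.inr ⟨rfl, rfl⟩)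
      (mem_closure_of_forall_gt fun b hb => ?_) (mem_closure_of_forall_lt fun b hb => ?_)
      (fun q hq => ?_) (fun q hq => ?_) ?_ ?_ ?_
    · exact lt_of_eq_of_lt heq.symm (Subtype.coe_lt_coe.mpr hb)
    · exact lt_of_lt_of_eq (Subtype.coe_lt_coe.mpr hb) heq
    · rw [normalExponent_neg_iff (Or.inr rfl), e1]
      have hq' : 2 - (q.2 : ℝ) < 1 / q.1 := sub_lt_comm.mp hq
      rw [lt_div_iff₀ (h0 q)] at hq'
      linarith
    · rw [normalExponent_pos_iff (Or.inr rfl), e1]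
      have hq' : 1 / (q.1 : ℝ) < 2 - q.2 := lt_sub_comm.mp hq
      rw [div_lt_iff₀ (h0 q)] at hq'
      linarith
    · rw [normalExponent_eq_log (Or.inr rfl), e1, hcurve, Real.log_one, zero_div]
    · rw [normalExponent_neg_iff (Or.inl rfl), e0]
      nlinarith [p.1.2.1, p.1.2.2, p.2.2.1, p.2.2.2]
    -- On this curve `β₁ - β₂ = (1-β₁)(1-β₂)`.
    · have : 0 < (1 - (p.1 : ℝ)) * (1 - p.2) :=
        mul_pos (sub_pos.mpr p.1.2.2) (sub_pos.mpr p.2.2.2)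
      rw [meanDrift, Icc.coe_zero]
      nlinarith
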